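/- Let $\mathcal R>0$, let $q\ge 1$ be an integer, and consider $$\frac{dr}{dt}=f(r,\varphi,S(t),t),\qquad \frac{d\varphi}{dt}=\omega(r)+g(r,\varphi,S(t),t),\qquad (1)$$ where $\omega(r)>0$, $f(r,\varphi,S,t)$, $g(r,\varphi,S,t)$ are $C^\infty$ for $|r|\le\mathcal R$, $(\varphi,S)\in\mathbb R^2$, $t>0$, and $f,g$ are $2\pi$-periodic in $\varphi$ and in $S$. Suppose that: * $f\sim\sum_{j\ge1}t^{-j/q}f_j(r,\varphi,S)$ and $g\sim\sum_{j\ge1}t^{-j/q}g_j(r,\varphi,S)$ as $t\to\infty$, where $f_j,g_j$ are $C^\infty$ and $2\pi$-periodic in $\varphi$ and in $S$; that is, for every $M\ge1$ one has $f-\sum_{j=1}^{M-1}t^{-j/q}f_j=\mathcal O(t^{-M/q})$ uniformly for $|r|\le\mathcal R$, $(\varphi,S)\in\mathbb R^2$, and likewise for $g$; * $S(t)=s_0t+\sum_{j=1}^{q-1}s_jt^{1-j/q}+s_q\log t$ with real constants $s_j$, $s_0>0$; * there are $a$ with $0<|a|<\mathcal R$ and coprime positive integers $\kappa,\varkappa$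 with $\kappa s_0=\varkappa\,\omega(a)$ and $\eta:=\omega'(a)\ne0$. For $\varsigma\in(0,1)$, $\epsilon\ge0$, $\tau>0$ put $$\mathcal D^{\epsilon}_{\varsigma,\tau}=\{(R,\Psi,t)\in\mathbb R^3:\ |Rt^{-\frac{1-\varsigma}{2q}}+a|<\mathcal R-\epsilon t^{-\frac{1-\varsigma}{2q}},\ t\ge\tau\}.$$ Then there are functions $\Lambda_k(\rho,\psi)$, $\Omega_k(\rho,\psi)$, $k\ge1$, which are polynomials in $\rho$ of degree at most $k-1$ and at most $k$, respectively, with coefficients that are $C^\infty$ and $2\pi$-periodic in $\psi$, with $$\Lambda_1(\rho,\psi)=\frac1{2\pi\varkappa}\int_0^{2\pi\varkappa}f_1\Big(a,\frac{\kappa}{\varkappa}S+\psi,S\Big)dS,\qquad \Omega_1(\rho,\psi)=\eta\rho,$$ such that for all integers $N\ge1$, all $\varsigma\in(0,1)$ and all $\epsilon\in(0,\mathcal R)$ there exist $t_0\ge1$ and functions $\tilde\rho_N(R,\Psi,t)$, $\tilde\psi_N(R,\Psi,t)$, $C^\infty$ for $t>0$ and $2\pi$-periodic in $\Psi$, with the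 following properties. 1. $|\tilde\rho_N|\le\epsilon$ and $|\tilde\psi_N|\le\epsilon$ on $\mathcal D^0_{\varsigma,t_0}$. For each $t\ge t_0$ the map $(R,\Psi)\mapsto(\rho,\psi)=(R+\tilde\rho_N(R,\Psi,t),\,\Psi+\tilde\psi_N(R,\Psi,t))$ is one-to-one on $\{(R,\Psi):(R,\Psi,t)\in\mathcal D^0_{\varsigma,t_0}\}$, and it has an inverse which is defined and $C^\infty$ in $(\rho,\psi,t)$ on $\mathcal D^\epsilon_{\varsigma,t_0}$ and takes values in $\mathcal D^0_{\varsigma,t_0}$. 2. The change of variables $r=a+t^{-1/(2q)}R$, $\varphi=\frac{\kappa}{\varkappa}S(t)+\Psi$, $\rho=R+\tilde\rho_N(R,\Psi,t)$, $\psi=\Psi+\tilde\psi_N(R,\Psi,t)$ takes system (1) into $$\frac{d\rho}{dt}=\Lambda_N(\rho,\psi,S(t),t),\qquad\frac{d\psi}{dt}=\Omega_N(\rho,\psi,S(t),t)$$ as long as $(R,\Psi,t)\in\mathcal D^0_{\varsigma,t_0}$ and $(\rho,\psi,t)\in\mathcal D^\epsilon_{\varsigma,t_0}$. Here $\Lambda_N(\rho,\psi,S,t)$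 and $\Omega_N(\rho,\psi,S,t)$ (not to be confused with $\Lambda_k(\rho,\psi)$, $\Omega_k(\rho,\psi)$) are defined for $(\rho,\psi,t)\in\mathcal D^\epsilon_{\varsigma,t_0}$ and $S\in\mathbb R$, and are $2\pi$-periodic in $\psi$ and $2\pi\varkappa$-periodic in $S$. 3. One has $$\Lambda_N(\rho,\psi,S,t)=\sum_{k=1}^Nt^{-\frac k{2q}}\Lambda_k(\rho,\psi)+\tilde\Lambda_N(\rho,\psi,S,t),\qquad \Omega_N(\rho,\psi,S,t)=\sum_{k=1}^Nt^{-\frac k{2q}}\Omega_k(\rho,\psi)+\tilde\Omega_N(\rho,\psi,S,t),$$ where $\tilde\Lambda_N,\tilde\Omega_N=\mathcal O(t^{-(N+1)/(2q)})$ as $t\to\infty$ in $\mathcal D^\epsilon_{\varsigma,t_0}$, uniformly in $(\psi,S)\in\mathbb R^2$ and in $\rho$ from any bounded set. 4. Moreover, $\tilde\Lambda_N\sim\sum_{k\ge N+1}t^{-k/(2q)}\tilde\Lambda_{N,k}(\rho,\psi,S)$ and $\tilde\Omega_N\sim\sum_{k\ge N+1}t^{-k/(2q)}\tilde\Omega_{N,k}(\rho,\psi,S)$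 as $t\to\infty$. The coefficients are $2\pi$-periodic in $\psi$ and $2\pi\varkappa$-periodic in $S$, with $\tilde\Lambda_{N,k}=\mathcal O((1+|\rho|)^{k-1})$ and $\tilde\Omega_{N,k}=\mathcal O((1+|\rho|)^{k})$ uniformly in $(\psi,S)\in\mathbb R^2$. For every $M\ge N$, the error of the partial sum over $N+1\le k\le M$ is $\mathcal O\big(t^{-(M+1)/(2q)}(1+|\rho|)^{M}\big)$ for $\tilde\Lambda_N$ and $\mathcal O\big(t^{-(M+1)/(2q)}(1+|\rho|)^{M+1}\big)$ for $\tilde\Omega_N$, uniformly for $(\rho,\psi,t)\in\mathcal D^\epsilon_{\varsigma,t_0}$ with $t$ large and $S\in\mathbb R$. -/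

import Mathlib

open scoped ContDiff

noncomputable section

/-- The phase `S(t) = s₀ t + ∑_{j=1}^{q-1} s_j t^{1-j/q} + s_q log t`. -/
def phase (q : ℕ) (s : ℕ → ℝ) (t : ℝ) : ℝ :=
  s 0 * t + ∑ j ∈ Finset.Ico 1 q, s j * t ^ (1 - (j : ℝ) / (q : ℝ)) + s q * Real.log t

/-- `h(r, φ, S, t)` is `C^∞` on `{|r| ≤ L, φ, S ∈ ℝ, t > 0}` and `2π`-periodic there with respect
to `φ` and to `S`. -/
def IsPerturbation (L : ℝ) (h : ℝ → ℝ → ℝ → ℝ → ℝ) : Prop :=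
  ContDiffOn ℝ ∞ (fun p : ℝ × ℝ × ℝ × ℝ => h p.1 p.2.1 p.2.2.1 p.2.2.2)
    (Set.Icc (-L) L ×ˢ Set.univ ×ˢ Set.univ ×ˢ Set.Ioi 0) ∧
  ∀ r φ S t : ℝ, |r| ≤ L → 0 < t →
    h r (φ + 2 * Real.pi) S t = h r φ S t ∧ h r φ (S + 2 * Real.pi) t = h r φ S t

/-- `c(r, φ, S)` is `C^∞` on `{|r| ≤ L, φ, S ∈ ℝ}` and `2π`-periodic there with respect
to `φ` and to `S`. -/
def IsCoefficient (L : ℝ) (c : ℝ → ℝ → ℝ → ℝ) : Prop :=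
  ContDiffOn ℝ ∞ (fun p : ℝ × ℝ × ℝ => c p.1 p.2.1 p.2.2)
    (Set.Icc (-L) L ×ˢ Set.univ ×ˢ Set.univ) ∧
  ∀ r φ S : ℝ, |r| ≤ L →
    c r (φ + 2 * Real.pi) S = c r φ S ∧ c r φ (S + 2 * Real.pi) = c r φ S

/-- `h(r, φ, S, t) ∼ ∑_{j ≥ 1} t^{-j/q} c_j(r, φ, S)` as `t → ∞`, uniformly for
`|r| ≤ L` and `(φ, S) ∈ ℝ²`. -/
def HasPowerExpansion (L : ℝ) (q : ℕ) (h : ℝ → ℝ → ℝ → ℝ → ℝ)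
    (c : ℕ → ℝ → ℝ → ℝ → ℝ) : Prop :=
  ∀ M : ℕ, 1 ≤ M → ∃ C T : ℝ, 0 < T ∧ ∀ r φ S t : ℝ, |r| ≤ L → T ≤ t →
    |h r φ S t - ∑ j ∈ Finset.Ico 1 M, t ^ (-((j : ℝ) / (q : ℝ))) * c j r φ S|
      ≤ C * t ^ (-((M : ℝ) / (q : ℝ)))

/-- The domain `{(R, Ψ, t) : |R t^{-(1-ς)/(2q)} + a| < L - ε t^{-(1-ς)/(2q)}, t ≥ τ}`. -/
def resonanceDomain (L a : ℝ) (q : ℕ) (ε ς τ : ℝ) : Set (ℝ × ℝ × ℝ) :=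
  {p | |p.1 * p.2.2 ^ (-((1 - ς) / (2 * (q : ℝ)))) + a|
        < L - ε * p.2.2 ^ (-((1 - ς) / (2 * (q : ℝ)))) ∧ τ ≤ p.2.2}

/-- The mean of `F` over the period `2πn`. -/
def phaseAverage (n : ℕ) (F : ℝ → ℝ) : ℝ :=
  1 / (2 * Real.pi * (n : ℝ)) * ∫ S in (0 : ℝ)..(2 * Real.pi * (n : ℝ)), F S

/-- `P(ρ, ψ)` is a polynomial in `ρ` of degree at most `d`, whose coefficients are `C^∞` and
`2π`-periodic functions of `ψ`. -/
def IsPolynomialOfDegreeLE (d : ℕ) (P : ℝ → ℝ → ℝ) : Prop :=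
  ∃ c : ℕ → ℝ → ℝ,
    (∀ i, ContDiff ℝ ∞ (c i) ∧ ∀ ψ, c i (ψ + 2 * Real.pi) = c i ψ) ∧
    ∀ ρ ψ, P ρ ψ = ∑ i ∈ Finset.range (d + 1), c i ψ * ρ ^ i

/-- The map `(R, Ψ) ↦ (R + X(R, Ψ, t), Ψ + Y(R, Ψ, t))`, depending on the time `t`, is a smooth
change of variables that is `ε`-close to the identity on `D₀`: the corrections `X`, `Y` are smooth,
`2π`-periodic in `Ψ` and at most `ε` on `D₀`; for each time the map is one-to-one on `D₀`, and it
has a smooth inverse `(ρ, ψ, t) ↦ (u, v)` that is defined on `D₁` and takes values in `D₀`. -/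
structure IsNearIdentityChange (ε : ℝ) (D₀ D₁ : Set (ℝ × ℝ × ℝ)) (X Y : ℝ → ℝ → ℝ → ℝ) :
    Prop where
  smooth_X : ContDiffOn ℝ ∞ (fun p : ℝ × ℝ × ℝ => X p.1 p.2.1 p.2.2)
    (Set.univ ×ˢ Set.univ ×ˢ Set.Ioi 0)
  smooth_Y : ContDiffOn ℝ ∞ (fun p : ℝ × ℝ × ℝ => Y p.1 p.2.1 p.2.2)
    (Set.univ ×ˢ Set.univ ×ˢ Set.Ioi 0)
  periodic : ∀ R Ψ t : ℝ, 0 < t →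
    X R (Ψ + 2 * Real.pi) t = X R Ψ t ∧ Y R (Ψ + 2 * Real.pi) t = Y R Ψ t
  small : ∀ R Ψ t : ℝ, (R, Ψ, t) ∈ D₀ → |X R Ψ t| ≤ ε ∧ |Y R Ψ t| ≤ ε
  injective : ∀ R Ψ R' Ψ' t : ℝ, (R, Ψ, t) ∈ D₀ → (R', Ψ', t) ∈ D₀ →
    R + X R Ψ t = R' + X R' Ψ' t → Ψ + Y R Ψ t = Ψ' + Y R' Ψ' t → R = R' ∧ Ψ = Ψ'
  inverse : ∃ u v : ℝ → ℝ → ℝ → ℝ,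
    ContDiffOn ℝ ∞ (fun p : ℝ × ℝ × ℝ => u p.1 p.2.1 p.2.2) D₁ ∧
    ContDiffOn ℝ ∞ (fun p : ℝ × ℝ × ℝ => v p.1 p.2.1 p.2.2) D₁ ∧
    ∀ ρ ψ t : ℝ, (ρ, ψ, t) ∈ D₁ →
      (u ρ ψ t, v ρ ψ t, t) ∈ D₀ ∧
      u ρ ψ t + X (u ρ ψ t) (v ρ ψ t) t = ρ ∧
      v ρ ψ t + Y (u ρ ψ t) (v ρ ψ t) t = ψ

/-- `h(ρ, ψ, S, t) = O(t^{-(N+1)/(2q)})` as `t → ∞` in `D`, uniformly in `(ψ, S) ∈ ℝ²` and in `ρ`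
from any bounded set. -/
def IsRemainder (D : Set (ℝ × ℝ × ℝ)) (q N : ℕ) (h : ℝ → ℝ → ℝ → ℝ → ℝ) : Prop :=
  ∀ B : ℝ, ∃ C T : ℝ, 0 < T ∧ ∀ ρ ψ S t : ℝ, (ρ, ψ, t) ∈ D → |ρ| ≤ B → T ≤ t →
    |h ρ ψ S t| ≤ C * t ^ (-(((N : ℝ) + 1) / (2 * (q : ℝ))))

/-- `h(ρ, ψ, S, t) ∼ ∑_{k ≥ N+1} t^{-k/(2q)} c_k(ρ, ψ, S)` as `t → ∞`, where each `c_k` is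
`2π`-periodic in `ψ`, `2πn`-periodic in `S` and `O((1 + |ρ|)^{k-1+e})` uniformly in `(ψ, S)`;
the error of the partial sum up to `k = M` is bounded on all of `D` (for large `t`) by a constant
times `t^{-(M+1)/(2q)} (1 + |ρ|)^{M+e}`, the size of the next term. -/
def HasRemainderExpansion (D : Set (ℝ × ℝ × ℝ)) (q n N e : ℕ)
    (h : ℝ → ℝ → ℝ → ℝ → ℝ) : Prop :=
  ∃ c : ℕ → ℝ → ℝ → ℝ → ℝ,
    (∀ k, N + 1 ≤ k →
      (∀ ρ ψ S : ℝ, c k ρ (ψ + 2 * Real.pi) S = c k ρ ψ S ∧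
        c k ρ ψ (S + 2 * Real.pi * (n : ℝ)) = c k ρ ψ S) ∧
      ∃ C : ℝ, ∀ ρ ψ S : ℝ, |c k ρ ψ S| ≤ C * (1 + |ρ|) ^ (k - 1 + e)) ∧
    ∀ M : ℕ, N ≤ M → ∃ C T : ℝ, 0 < T ∧ ∀ ρ ψ S t : ℝ, (ρ, ψ, t) ∈ D → T ≤ t →
      |h ρ ψ S t - ∑ k ∈ Finset.Icc (N + 1) M, t ^ (-((k : ℝ) / (2 * (q : ℝ)))) * c k ρ ψ S|
        ≤ C * (1 + |ρ|) ^ (M + e) * t ^ (-(((M : ℝ) + 1) / (2 * (q : ℝ))))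

end

/-! Put `δ = t^{-1/(2q)}` and `x = δ R`. Along a solution `δ' = -δ^{2q+1}/(2q)`, `x' = f`, `S' = s₀
+ O(δ²)` and `Ψ' = ω(a + x) - ω(a) + g - (κ/ϰ)(S' - s₀)`, where the resonance has cancelled the
constant terms. After truncation of the expansions, the right-hand sides are smooth in `(δ, x, Ψ,
S)`, periodic in `Ψ` and `S`, and `S` is the only variable that still moves at `δ = x = 0`.
Everything is therefore graded by the powers of the ideal generated by `δ` and `x` (`HasOrder`). On
`x = δρ` a form of degree `k` in `(δ, x)` equals `δ^k` times a polynomial of degree at most `k` in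
`ρ`. This one fact gives the degrees of `Λ_k` and `Ω_k` and the growth in `ρ` of the coefficients
and errors.

Averaging: the derivative along the flow is `s₀ ∂_S` up to terms that raise the order by one
(`hasOrder_transport`). Hence the leading form `h` of an error can be replaced by its mean `m` over
`S`: the correction is enlarged by a form `p` with `s₀ ∂_S p = m - h` (`IsForm.exists_primitive`,
`averaging_step`), and `exists_averaging` iterates this.

The functions `f` and `g` are controlled near `δ = 0` only through their expansions. So `P` and `Q`
are built from truncations and serve all truncations `M ≥ N` at once. The rates are affine in the
fields and do not differentiate them, so the exact rates inherit the error bounds of the expansions.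

Inversion: in `(δ, x, Ψ, S)` the change of variables adds `δ² P` to `x` and `Q` to `Ψ`, both of
order two, so it is tangent to the identity at `δ = x = 0`. Cut off close to that set, it becomes a
global diffeomorphism whose inverse is a smooth periodic shear (`exists_inverse_shear`), and
composition with this inverse preserves orders. Since `ς > 0`, both `δ` and `δ R` are uniformly
small on the domains for large `t` (`exists_time`), so the cut-off is inactive there. -/

/-! ### Smoothness of integrals depending on parameters. -/

section ParametricIntegral

open MeasureTheory

theorem hasFDerivAt_parametric_intervalIntegral {E F : Type} [NormedAddCommGroup E]
    [NormedSpace ℝ E] [NormedAddCommGroup F] [NormedSpace ℝ F] [CompleteSpace F]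
    {g : E × ℝ → F} (hg : ContDiff ℝ 1 g) (b : ℝ) (x₀ : E) :
    HasFDerivAt (fun x => ∫ u in (0 : ℝ)..b, g (x, u))
      (∫ u in (0 : ℝ)..b, (fderiv ℝ g (x₀, u)).comp (ContinuousLinearMap.inl ℝ E ℝ)) x₀ := by
  have hc : Continuous fun p : E × ℝ => (fderiv ℝ g p).comp (ContinuousLinearMap.inl ℝ E ℝ) :=
    (hg.continuous_fderiv one_ne_zero).clm_comp continuous_const
  have hnorm : Continuous fun p : E × ℝ =>
      ‖(fderiv ℝ g p).comp (ContinuousLinearMap.inl ℝ E ℝ)‖ := hc.norm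
  obtain ⟨C, hC⟩ := (isCompact_uIcc (a := (0 : ℝ)) (b := b)).exists_bound_of_continuousOn
    (f := fun u => (fderiv ℝ g (x₀, u)).comp (ContinuousLinearMap.inl ℝ E ℝ))
    (by fun_prop)
  -- a neighbourhood of `x₀` on which the derivative is bounded by `C + 1` for all `u`
  have hev : ∀ᶠ x in nhds x₀, ∀ u ∈ Set.uIcc (0 : ℝ) b,
      ‖(fderiv ℝ g (x, u)).comp (ContinuousLinearMap.inl ℝ E ℝ)‖ < C + 1 := by
    refine isCompact_uIcc.eventually_forall_of_forall_eventually ?_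
    intro u hu
    have : ‖(fderiv ℝ g (x₀, u)).comp (ContinuousLinearMap.inl ℝ E ℝ)‖ < C + 1 :=
      lt_of_le_of_lt (hC u hu) (by linarith)
    have := hnorm.continuousAt.eventually_lt (x₀ := (x₀, u)) continuousAt_const this
    exact this
  refine intervalIntegral.hasFDerivAt_integral_of_dominated_of_fderiv_le
    (F := fun x u => g (x, u)) (a := 0) (b := b)
    (F' := fun x u => (fderiv ℝ g (x, u)).comp (ContinuousLinearMap.inl ℝ E ℝ))
    (bound := fun _ => C + 1) hev ?_ ?_ ?_ ?_ ?_ ?_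
  · refine Filter.Eventually.of_forall fun x => ?_
    exact (hg.continuous.comp (by fun_prop : Continuous fun u : ℝ => (x, u))).aestronglyMeasurable
  · exact (hg.continuous.comp
      (by fun_prop : Continuous fun u : ℝ => (x₀, u))).intervalIntegrable _ _
  · exact (hc.comp (by fun_prop : Continuous fun u : ℝ => (x₀, u))).aestronglyMeasurable
  · refine Filter.Eventually.of_forall fun u hu x hx => ?_
    exact (hx u (Set.uIoc_subset_uIcc hu)).le
  · exact intervalIntegrable_const
  · refine Filter.Eventually.of_forall fun u _ x _ => ?_
    have h1 : HasFDerivAt g (fderiv ℝ g (x, u)) (x, u) :=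
      (hg.differentiable one_ne_zero _).hasFDerivAt
    exact h1.comp x (hasFDerivAt_prodMk_left x u)

/-- The derivative is an integral of the same kind with values in `E →L[ℝ] F`, so the induction has
to range over all target spaces. -/
theorem contDiff_nat_parametric_intervalIntegral (n : ℕ) (b : ℝ) :
    ∀ {E F : Type} [NormedAddCommGroup E]
    [NormedSpace ℝ E] [NormedAddCommGroup F] [NormedSpace ℝ F] [CompleteSpace F]
    {g : E × ℝ → F}, ContDiff ℝ ∞ g →
    ContDiff ℝ n (fun x => ∫ u in (0 : ℝ)..b, g (x, u)) := by
  induction n with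
  | zero =>
    intro E F _ _ _ _ _ g hg
    refine contDiff_zero.2 (continuous_iff_continuousAt.2 fun x => ?_)
    exact (hasFDerivAt_parametric_intervalIntegral (hg.of_le (by exact_mod_cast le_top)) b
      x).continuousAt
  | succ n ih =>
    intro E F _ _ _ _ _ g hg
    have h1 : ContDiff ℝ 1 g := hg.of_le (by exact_mod_cast le_top)
    refine contDiff_succ_iff_hasFDerivAt.2 ⟨_, ?_, fun x =>
      hasFDerivAt_parametric_intervalIntegral h1 b x⟩
    refine ih (g := fun p => (fderiv ℝ g p).comp (ContinuousLinearMap.inl ℝ E ℝ)) ?_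
    exact (hg.fderiv_right (m := ∞) (by norm_cast)).clm_comp contDiff_const

theorem contDiff_parametric_intervalIntegral {E F : Type} [NormedAddCommGroup E]
    [NormedSpace ℝ E] [NormedAddCommGroup F] [NormedSpace ℝ F] [CompleteSpace F]
    {g : E × ℝ → F} (hg : ContDiff ℝ ∞ g) (b : ℝ) :
    ContDiff ℝ ∞ (fun x => ∫ u in (0 : ℝ)..b, g (x, u)) :=
  contDiff_infty.2 fun n => contDiff_nat_parametric_intervalIntegral n b hg

end ParametricIntegral

/-! ### Smooth doubly periodic functions and equivariant maps. -/

/-- The space of the variables `(δ, x, Ψ, S)`. -/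
abbrev Pt := ℝ × ℝ × ℝ × ℝ

/-- The two periods: `2π` in `Ψ` and `2πn` in `S`. -/
def IsPeriod (n : ℕ) (w : Pt) : Prop :=
  w = (0, 0, 2 * Real.pi, 0) ∨ w = (0, 0, 0, 2 * Real.pi * (n : ℝ))

theorem IsPeriod.fst_eq {n : ℕ} {w : Pt} (h : IsPeriod n w) : w.1 = 0 := by
  rcases h with rfl | rfl <;> rfl

theorem IsPeriod.snd_eq {n : ℕ} {w : Pt} (h : IsPeriod n w) : w.2.1 = 0 := by
  rcases h with rfl | rfl <;> rfl

/-- Smooth functions with the two periods. -/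
structure IsSymbol (n : ℕ) (H : Pt → ℝ) : Prop where
  smooth : ContDiff ℝ ∞ H
  periodic : ∀ w, IsPeriod n w → ∀ p, H (p + w) = H p

/-- Smooth maps that commute with the translations by the two periods. -/
structure IsEquivariant (n : ℕ) (Φ : Pt → Pt) : Prop where
  smooth : ContDiff ℝ ∞ Φ
  equivariant : ∀ w, IsPeriod n w → ∀ p, Φ (p + w) = Φ p + w

/-- The derivative of `H` in the direction `v`. -/
noncomputable def dirDeriv (v : Pt) (H : Pt → ℝ) (p : Pt) : ℝ := fderiv ℝ H p v

/-- The map `(δ, x, Ψ, S) ↦ (δ, x + α, Ψ + β, S)`. -/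
def shear (α β : Pt → ℝ) (p : Pt) : Pt := (p.1, p.2.1 + α p, p.2.2.1 + β p, p.2.2.2)

/-- The projection `(δ, x, Ψ, S) ↦ (0, 0, Ψ, S)`. -/
def core (p : Pt) : Pt := (0, 0, p.2.2.1, p.2.2.2)

namespace IsSymbol

variable {n : ℕ} {H K : Pt → ℝ}

theorem const (c : ℝ) : IsSymbol n fun _ => c := ⟨contDiff_const, fun _ _ _ => rfl⟩

theorem fst : IsSymbol n fun p => p.1 :=
  ⟨by fun_prop, fun w hw p => by simp [hw.fst_eq]⟩

theorem snd : IsSymbol n fun p => p.2.1 :=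
  ⟨by fun_prop, fun w hw p => by simp [hw.snd_eq]⟩

theorem add (hH : IsSymbol n H) (hK : IsSymbol n K) : IsSymbol n fun p => H p + K p :=
  ⟨hH.smooth.add hK.smooth, fun w hw p => by simp only [hH.periodic w hw, hK.periodic w hw]⟩

theorem sub (hH : IsSymbol n H) (hK : IsSymbol n K) : IsSymbol n fun p => H p - K p :=
  ⟨hH.smooth.sub hK.smooth, fun w hw p => by simp only [hH.periodic w hw, hK.periodic w hw]⟩

theorem mul (hH : IsSymbol n H) (hK : IsSymbol n K) : IsSymbol n fun p => H p * K p :=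
  ⟨hH.smooth.mul hK.smooth, fun w hw p => by simp only [hH.periodic w hw, hK.periodic w hw]⟩

theorem pow (hH : IsSymbol n H) (k : ℕ) : IsSymbol n fun p => H p ^ k :=
  ⟨hH.smooth.pow k, fun w hw p => by simp only [hH.periodic w hw]⟩

theorem directional (hH : IsSymbol n H) (v : Pt) : IsSymbol n (dirDeriv v H) := by
  refine ⟨(hH.smooth.fderiv_right (m := ∞) (by norm_cast)).clm_apply contDiff_const, ?_⟩
  intro w hw p
  have : (fun p => H (p + w)) = H := funext (hH.periodic w hw)
  have h2 := fderiv_comp_add_right (𝕜 := ℝ) (f := H) (x := p) w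
  rw [this] at h2
  simp only [dirDeriv, h2]

theorem comp (hH : IsSymbol n H) {Φ : Pt → Pt} (hΦ : IsEquivariant n Φ) :
    IsSymbol n fun p => H (Φ p) :=
  ⟨hH.smooth.comp hΦ.smooth, fun w hw p => by
    simp only [hΦ.equivariant w hw, hH.periodic w hw]⟩

theorem differentiableAt (hH : IsSymbol n H) (p : Pt) : DifferentiableAt ℝ H p :=
  hH.smooth.differentiable (by norm_num) p

end IsSymbol

theorem isEquivariant_shear {n : ℕ} {α β : Pt → ℝ} (hα : IsSymbol n α) (hβ : IsSymbol n β) :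
    IsEquivariant n (shear α β) := by
  have h1 := hα.smooth
  have h2 := hβ.smooth
  refine ⟨by unfold shear; fun_prop, fun w hw p => ?_⟩
  simp only [shear, hα.periodic w hw, hβ.periodic w hw, Prod.fst_add, Prod.snd_add,
    hw.fst_eq, hw.snd_eq]
  ext <;> simp [hw.fst_eq, hw.snd_eq]
  all_goals ring

theorem isEquivariant_core (n : ℕ) : IsEquivariant n core := by
  refine ⟨by unfold core; fun_prop, fun w hw p => ?_⟩
  ext <;> simp [core, hw.fst_eq, hw.snd_eq]

theorem isEquivariant_id (n : ℕ) : IsEquivariant n fun p => p :=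
  ⟨contDiff_id, fun _ _ _ => rfl⟩

theorem shear_zero (p : Pt) : shear (fun _ => 0) (fun _ => 0) p = p := by
  ext <;> simp [shear]

/-- The expansion of a derivative in coordinates. -/
theorem fderiv_eq_sum_dirDeriv (H : Pt → ℝ) (p v : Pt) :
    fderiv ℝ H p v = v.1 * dirDeriv (1, 0, 0, 0) H p + v.2.1 * dirDeriv (0, 1, 0, 0) H p
      + v.2.2.1 * dirDeriv (0, 0, 1, 0) H p + v.2.2.2 * dirDeriv (0, 0, 0, 1) H p := by
  have hv : v = v.1 • (1, 0, 0, 0) + v.2.1 • (0, 1, 0, 0) + v.2.2.1 • (0, 0, 1, 0)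
      + v.2.2.2 • ((0, 0, 0, 1) : Pt) := by
    ext <;> simp
  conv_lhs => rw [hv]
  simp only [map_add, map_smul, smul_eq_mul, dirDeriv]

/-- The mean value theorem in integral form, with smooth periodic coefficients. -/
theorem IsSymbol.exists_increment {n : ℕ} {K : Pt → ℝ} (hK : IsSymbol n K) {Φ Φ' : Pt → Pt}
    (hΦ : IsEquivariant n Φ) (hΦ' : IsEquivariant n Φ') :
    ∃ W₀ W₁ W₂ W₃ : Pt → ℝ, IsSymbol n W₀ ∧ IsSymbol n W₁ ∧ IsSymbol n W₂ ∧ IsSymbol n W₃ ∧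
      ∀ p, K (Φ' p) - K (Φ p) = (Φ' p - Φ p).1 * W₀ p + (Φ' p - Φ p).2.1 * W₁ p
        + (Φ' p - Φ p).2.2.1 * W₂ p + (Φ' p - Φ p).2.2.2 * W₃ p := by
  -- The difference `Φ' - Φ` is invariant under the periods, so the whole segment from `Φ p` to `Φ'
  -- p` is translated with `p` and the averaged derivatives are periodic.
  have hsym : ∀ v : Pt, IsSymbol n fun p =>
      ∫ u in (0 : ℝ)..1, dirDeriv v K (Φ p + u • (Φ' p - Φ p)) := by
    intro v
    have h1 := (hK.directional v).smooth
    have h2 := hΦ.smooth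
    have h3 := hΦ'.smooth
    refine ⟨contDiff_parametric_intervalIntegral
      (g := fun z : Pt × ℝ => dirDeriv v K (Φ z.1 + z.2 • (Φ' z.1 - Φ z.1))) ?_ 1, ?_⟩
    · refine h1.comp ?_
      fun_prop
    · intro w hw p
      refine intervalIntegral.integral_congr fun u _ => ?_
      simp only [hΦ.equivariant w hw, hΦ'.equivariant w hw, add_sub_add_right_eq_sub]
      rw [add_right_comm, (hK.directional v).periodic w hw]
  refine ⟨_, _, _, _, hsym (1, 0, 0, 0), hsym (0, 1, 0, 0), hsym (0, 0, 1, 0),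
    hsym (0, 0, 0, 1), fun p => ?_⟩
  set d := Φ' p - Φ p with hd
  have hline : ∀ u : ℝ, HasDerivAt (fun u : ℝ => K (Φ p + u • d))
      (fderiv ℝ K (Φ p + u • d) d) u := by
    intro u
    have h1 : HasDerivAt (fun u : ℝ => Φ p + u • d) d u := by
      simpa using ((hasDerivAt_id u).smul_const d).const_add (Φ p)
    exact (hK.differentiableAt _).hasFDerivAt.comp_hasDerivAt u h1
  have hcont : ∀ v : Pt, Continuous fun u : ℝ => dirDeriv v K (Φ p + u • d) := fun v =>
    (hK.directional v).smooth.continuous.comp (by fun_prop)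
  have hint := intervalIntegral.integral_eq_sub_of_hasDerivAt (a := 0) (b := 1)
    (fun u _ => hline u) ((hcont d).intervalIntegrable 0 1)
  have hend : Φ p + d = Φ' p := by rw [hd]; abel
  simp only [one_smul, zero_smul, add_zero, hend] at hint
  rw [← hint]
  simp only [fderiv_eq_sum_dirDeriv K _ d]
  have hi : ∀ (c : ℝ) (v : Pt), IntervalIntegrable
      (fun u : ℝ => c * dirDeriv v K (Φ p + u • d)) MeasureTheory.volume 0 1 := fun c v =>
    (continuous_const.mul (hcont v)).intervalIntegrable _ _
  rw [intervalIntegral.integral_add (((hi _ _).add (hi _ _)).add (hi _ _)) (hi _ _),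
    intervalIntegral.integral_add ((hi _ _).add (hi _ _)) (hi _ _),
    intervalIntegral.integral_add (hi _ _) (hi _ _)]
  simp only [intervalIntegral.integral_const_mul]

/-! ### Powers of the ideal generated by `δ` and `x`, and homogeneous forms. -/

/-- The ideal of functions that vanish to the order `k` on `{δ = x = 0}`. -/
def HasOrder (n : ℕ) : ℕ → (Pt → ℝ) → Prop
  | 0, H => IsSymbol n H
  | k + 1, H => ∃ A B, HasOrder n k A ∧ HasOrder n k B ∧ H = fun p => p.1 * A p + p.2.1 * B p

/-- Homogeneous polynomials of degree `k` in `(δ, x)`, whose coefficients are smooth periodic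
functions of `(Ψ, S)`. -/
def IsForm (n : ℕ) : ℕ → (Pt → ℝ) → Prop
  | 0, H => IsSymbol n H ∧ ∀ p, H p = H (core p)
  | k + 1, H => ∃ A B, IsForm n k A ∧ IsForm n k B ∧ H = fun p => p.1 * A p + p.2.1 * B p

namespace HasOrder

variable {n : ℕ}

theorem isSymbol : ∀ {k : ℕ} {H : Pt → ℝ}, HasOrder n k H → IsSymbol n H
  | 0, _, h => h
  | _ + 1, _, ⟨_, _, hA, hB, e⟩ =>
    e ▸ (IsSymbol.fst.mul hA.isSymbol).add (IsSymbol.snd.mul hB.isSymbol)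

theorem congr {k : ℕ} {H K : Pt → ℝ} (h : HasOrder n k H) (e : ∀ p, K p = H p) :
    HasOrder n k K := funext e ▸ h

theorem zero : ∀ k : ℕ, HasOrder n k fun _ => 0
  | 0 => IsSymbol.const 0
  | k + 1 => ⟨_, _, zero k, zero k, by simp⟩

theorem add : ∀ {k : ℕ} {H K : Pt → ℝ}, HasOrder n k H → HasOrder n k K →
    HasOrder n k fun p => H p + K p
  | 0, _, _, h, h' => IsSymbol.add h h'
  | _ + 1, _, _, ⟨_, _, hA, hB, e⟩, ⟨_, _, hA', hB', e'⟩ =>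
    ⟨_, _, hA.add hA', hB.add hB', by subst e e'; funext p; ring⟩

theorem symbol_mul : ∀ {k : ℕ} {H K : Pt → ℝ}, IsSymbol n H → HasOrder n k K →
    HasOrder n k fun p => H p * K p
  | 0, _, _, h, h' => IsSymbol.mul h h'
  | _ + 1, _, _, h, ⟨_, _, hA', hB', e'⟩ =>
    ⟨_, _, symbol_mul h hA', symbol_mul h hB', by subst e'; funext p; ring⟩

theorem const_mul {k : ℕ} {K : Pt → ℝ} (c : ℝ) (h : HasOrder n k K) :
    HasOrder n k fun p => c * K p := symbol_mul (IsSymbol.const c) h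

theorem neg {k : ℕ} {K : Pt → ℝ} (h : HasOrder n k K) : HasOrder n k fun p => -K p := by
  simpa using h.const_mul (-1)

theorem sub {k : ℕ} {H K : Pt → ℝ} (h : HasOrder n k H) (h' : HasOrder n k K) :
    HasOrder n k fun p => H p - K p := by
  simpa [sub_eq_add_neg] using h.add h'.neg

theorem pred : ∀ {k : ℕ} {H : Pt → ℝ}, HasOrder n (k + 1) H → HasOrder n k H
  | _, _, ⟨_, _, hA, hB, e⟩ => e ▸ (symbol_mul IsSymbol.fst hA).add (symbol_mul IsSymbol.snd hB)

theorem mono {k l : ℕ} {H : Pt → ℝ} (h : HasOrder n l H) (hkl : k ≤ l) : HasOrder n k H := by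
  induction l, hkl using Nat.le_induction with
  | base => exact h
  | succ l _ ih => exact ih h.pred

theorem fst_mul {k : ℕ} {H : Pt → ℝ} (h : HasOrder n k H) :
    HasOrder n (k + 1) fun p => p.1 * H p := ⟨_, _, h, zero k, by simp⟩

theorem snd_mul {k : ℕ} {H : Pt → ℝ} (h : HasOrder n k H) :
    HasOrder n (k + 1) fun p => p.2.1 * H p := ⟨_, _, zero k, h, by simp⟩

theorem mul : ∀ {k l : ℕ} {H K : Pt → ℝ}, HasOrder n k H → HasOrder n l K →
    HasOrder n (k + l) fun p => H p * K p
  | 0, l, _, _, h, h' => (symbol_mul h h').mono (by omega)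
  | k + 1, l, _, _, ⟨_, _, hA, hB, e⟩, h' => by
    have := (hA.mul h').fst_mul.add (hB.mul h').snd_mul
    subst e
    rw [show k + 1 + l = k + l + 1 by omega]
    convert this using 2
    ring

theorem fst_pow_mul {k : ℕ} {H : Pt → ℝ} (h : HasOrder n k H) :
    ∀ m : ℕ, HasOrder n (k + m) fun p => p.1 ^ m * H p
  | 0 => by simpa using h
  | m + 1 => by
    have := (fst_pow_mul h m).fst_mul
    rw [← add_assoc]
    convert this using 2
    ring

theorem sum {ι : Type*} {k : ℕ} (s : Finset ι) {H : ι → Pt → ℝ}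
    (h : ∀ i ∈ s, HasOrder n k (H i)) : HasOrder n k fun p => ∑ i ∈ s, H i p := by
  classical
  induction s using Finset.induction_on with
  | empty => simpa using zero k
  | insert i s hi ih =>
    simp only [Finset.sum_insert hi]
    exact (h i (by simp)).add (ih fun j hj => h j (by simp [hj]))

end HasOrder

/-- Hadamard's lemma. -/
theorem IsSymbol.hasOrder_sub_core {n : ℕ} {K : Pt → ℝ} (hK : IsSymbol n K) :
    HasOrder n 1 fun p => K p - K (core p) := by
  obtain ⟨W₀, W₁, W₂, W₃, h₀, h₁, -, -, e⟩ :=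
    hK.exists_increment (isEquivariant_core n) (isEquivariant_id n)
  refine ⟨W₀, W₁, h₀, h₁, funext fun p => ?_⟩
  rw [e p]
  simp [core]

theorem IsSymbol.hasOrder_one {n : ℕ} {K : Pt → ℝ} (hK : IsSymbol n K)
    (h0 : ∀ Ψ S, K (0, 0, Ψ, S) = 0) : HasOrder n 1 K := by
  have := hK.hasOrder_sub_core
  simpa [core, h0] using this

theorem dirDeriv_add {H K : Pt → ℝ} {p : Pt} (v : Pt) (hH : DifferentiableAt ℝ H p)
    (hK : DifferentiableAt ℝ K p) :
    dirDeriv v (fun p => H p + K p) p = dirDeriv v H p + dirDeriv v K p := by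
  simp only [dirDeriv]
  rw [fderiv_fun_add hH hK]
  rfl

theorem dirDeriv_coords {A B : Pt → ℝ} {p : Pt} (v : Pt) (hA : DifferentiableAt ℝ A p)
    (hB : DifferentiableAt ℝ B p) :
    dirDeriv v (fun p => p.1 * A p + p.2.1 * B p) p
      = p.1 * dirDeriv v A p + p.2.1 * dirDeriv v B p + (v.1 * A p + v.2.1 * B p) := by
  have h1 : HasFDerivAt (fun p : Pt => p.1) (ContinuousLinearMap.fst ℝ ℝ (ℝ × ℝ × ℝ)) p :=
    hasFDerivAt_fst
  have h2 : HasFDerivAt (fun p : Pt => p.2.1) ((ContinuousLinearMap.fst ℝ ℝ (ℝ × ℝ)).comp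
      (ContinuousLinearMap.snd ℝ ℝ (ℝ × ℝ × ℝ))) p := hasFDerivAt_fst.comp p hasFDerivAt_snd
  have h := (h1.mul hA.hasFDerivAt).add (h2.mul hB.hasFDerivAt)
  have h' := HasFDerivAt.fderiv (f := fun p : Pt => p.1 * A p + p.2.1 * B p) h
  simp only [dirDeriv]
  rw [h']
  simp
  ring

namespace HasOrder

variable {n : ℕ}

theorem dirDeriv_pred (v : Pt) : ∀ {k : ℕ} {H : Pt → ℝ}, HasOrder n (k + 1) H →
    HasOrder n k (dirDeriv v H)
  | 0, _, h => h.isSymbol.directional v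
  | k + 1, _, ⟨A, B, hA, hB, e⟩ => by
    have h := ((dirDeriv_pred v hA).fst_mul.add (dirDeriv_pred v hB).snd_mul).add
      ((hA.const_mul v.1).add (hB.const_mul v.2.1))
    convert h using 1
    funext p
    rw [e, dirDeriv_coords v (hA.isSymbol.differentiableAt p) (hB.isSymbol.differentiableAt p)]

theorem dirDeriv_of_core {v : Pt} (h0 : v.1 = 0) (h1 : v.2.1 = 0) : ∀ {k : ℕ} {H : Pt → ℝ},
    HasOrder n k H → HasOrder n k (dirDeriv v H)
  | 0, _, h => h.isSymbol.directional v
  | k + 1, _, ⟨A, B, hA, hB, e⟩ => by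
    have h := (dirDeriv_of_core h0 h1 hA).fst_mul.add (dirDeriv_of_core h0 h1 hB).snd_mul
    convert h using 1
    funext p
    rw [e, dirDeriv_coords v (hA.isSymbol.differentiableAt p) (hB.isSymbol.differentiableAt p),
      h0, h1]
    ring

/-- The factor `δ` restores the order lost by differentiation. In `transport` every derivative in
`δ` or `x` carries such a factor. -/
theorem fst_mul_dirDeriv (v : Pt) {k : ℕ} {H : Pt → ℝ} (h : HasOrder n k H) :
    HasOrder n k fun p => p.1 * dirDeriv v H p := by
  cases k with
  | zero => exact IsSymbol.fst.mul (h.isSymbol.directional v)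
  | succ k => exact (h.dirDeriv_pred v).fst_mul

/-- Composition with a map that preserves the ideal generated by `δ` and `x`. -/
theorem comp {Φ : Pt → Pt} (hΦ : IsEquivariant n Φ) (h1 : HasOrder n 1 fun p => (Φ p).1)
    (h2 : HasOrder n 1 fun p => (Φ p).2.1) : ∀ {k : ℕ} {H : Pt → ℝ}, HasOrder n k H →
    HasOrder n k fun p => H (Φ p)
  | 0, _, h => IsSymbol.comp h hΦ
  | k + 1, _, ⟨A, B, hA, hB, e⟩ => by
    have h := (h1.mul (comp hΦ h1 h2 hA)).add (h2.mul (comp hΦ h1 h2 hB))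
    rw [add_comm 1 k] at h
    rw [e]
    exact h

theorem fst : HasOrder n 1 fun p => p.1 := by
  simpa using fst_mul (k := 0) (n := n) (IsSymbol.const 1)

theorem snd : HasOrder n 1 fun p => p.2.1 := by
  simpa using snd_mul (k := 0) (n := n) (IsSymbol.const 1)

theorem comp_shear {α β : Pt → ℝ} (hα : HasOrder n 1 α) (hβ : IsSymbol n β) {k : ℕ}
    {H : Pt → ℝ} (h : HasOrder n k H) : HasOrder n k fun p => H (shear α β p) :=
  comp (isEquivariant_shear hα.isSymbol hβ) fst (snd.add hα) h

/-- A shift of `x` moves a generator of the ideal and costs one order, while a shift of `Ψ` costs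
none; hence `α' - α` is required to have one order more than `β' - β`. The induction rests on `(x +
α')B' - (x + α)B = (x + α)(B' - B) + (α' - α)B'`. -/
theorem comp_shear_sub {α β α' β' : Pt → ℝ} (hα : HasOrder n 1 α) (hβ : IsSymbol n β)
    (hα' : HasOrder n 1 α') (hβ' : IsSymbol n β') {m : ℕ}
    (h1 : HasOrder n (m + 1) fun p => α' p - α p) (h2 : HasOrder n m fun p => β' p - β p) :
    ∀ {k : ℕ} {H : Pt → ℝ}, HasOrder n k H →
      HasOrder n (k + m) fun p => H (shear α' β' p) - H (shear α β p)
  | 0, H, h => by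
    obtain ⟨W₀, W₁, W₂, W₃, -, hW₁, hW₂, -, e⟩ :=
      IsSymbol.exists_increment h (isEquivariant_shear hα.isSymbol hβ)
        (isEquivariant_shear hα'.isSymbol hβ')
    have h := (symbol_mul hW₁ h1.pred).add (symbol_mul hW₂ h2)
    rw [zero_add]
    convert h using 2 with p
    rw [e p]
    simp [shear]
    ring
  | k + 1, H, ⟨A, B, hA, hB, e⟩ => by
    have i1 := (comp_shear_sub hα hβ hα' hβ' h1 h2 hA).fst_mul
    have i2 := (snd.add hα).mul (comp_shear_sub hα hβ hα' hβ' h1 h2 hB)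
    have i3 := h1.mul (comp_shear hα' hβ' hB)
    rw [show 1 + (k + m) = k + m + 1 by omega] at i2
    rw [show m + 1 + k = k + m + 1 by omega] at i3
    have h := (i1.add i2).add i3
    rw [show k + 1 + m = k + m + 1 by omega]
    convert h using 2 with p
    rw [e]
    simp only [shear]
    ring

end HasOrder

namespace IsForm

variable {n : ℕ}

theorem hasOrder : ∀ {k : ℕ} {H : Pt → ℝ}, IsForm n k H → HasOrder n k H
  | 0, _, h => h.1
  | _ + 1, _, ⟨_, _, hA, hB, e⟩ => ⟨_, _, hA.hasOrder, hB.hasOrder, e⟩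

theorem zero : ∀ k : ℕ, IsForm n k fun _ => 0
  | 0 => ⟨IsSymbol.const 0, fun _ => rfl⟩
  | k + 1 => ⟨_, _, zero k, zero k, by simp⟩

/-- Applied with `c = δ` and `x = ρ`, this converts the degree in `(δ, x)` into a power of `t`. -/
theorem homogeneous : ∀ {k : ℕ} {H : Pt → ℝ}, IsForm n k H → ∀ c x Ψ S : ℝ,
    H (c, c * x, Ψ, S) = c ^ k * H (1, x, Ψ, S)
  | 0, _, h, c, x, Ψ, S => by
    rw [h.2 (c, c * x, Ψ, S), h.2 (1, x, Ψ, S)]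
    simp [core]
  | k + 1, _, ⟨A, B, hA, hB, e⟩, c, x, Ψ, S => by
    rw [e]
    simp only [hA.homogeneous c x, hB.homogeneous c x]
    ring

theorem isPolynomialOfDegreeLE : ∀ {k : ℕ} {H : Pt → ℝ}, IsForm n k H →
    IsPolynomialOfDegreeLE k fun ρ ψ => H (1, ρ, ψ, 0)
  | 0, H, h => by
    refine ⟨fun _ ψ => H (0, 0, ψ, 0), fun i => ⟨?_, fun ψ => ?_⟩, fun ρ ψ => ?_⟩
    · have := h.1.smooth
      fun_prop
    · have := h.1.periodic _ (Or.inl rfl) (0, 0, ψ, 0)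
      simpa using this
    · simp [h.2 (1, ρ, ψ, 0), core]
  | k + 1, H, ⟨A, B, hA, hB, e⟩ => by
    obtain ⟨a, ha, ea⟩ := hA.isPolynomialOfDegreeLE
    obtain ⟨b, hb, eb⟩ := hB.isPolynomialOfDegreeLE
    refine ⟨fun i ψ => (if i ≤ k then a i ψ else 0) + (if i = 0 then 0 else b (i - 1) ψ),
      fun i => ⟨?_, fun ψ => ?_⟩, fun ρ ψ => ?_⟩
    · have h1 := (ha i).1
      have h2 := (hb (i - 1)).1
      beta_reduce
      split_ifs <;> fun_prop
    · simp only [(ha i).2, (hb (i - 1)).2]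
    · simp only [e, add_mul, Finset.sum_add_distrib]
      rw [Finset.sum_range_succ, Finset.sum_range_succ' (fun i => (if i = 0 then _ else _) * _)]
      have h1 := ea ρ ψ
      have h2 := eb ρ ψ
      simp only at h1 h2
      rw [h1, h2, Finset.mul_sum, Finset.mul_sum]
      simp only [Nat.succ_ne_zero, if_false, add_tsub_cancel_right, if_true, zero_mul, add_zero,
        Nat.not_succ_le_self, one_mul]
      congr 1
      · refine Finset.sum_congr rfl fun i hi => ?_
        rw [if_pos (by simpa [Nat.lt_succ_iff] using hi)]
      · refine Finset.sum_congr rfl fun i hi => ?_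
        ring

end IsForm

/-- Hadamard's lemma, applied to the innermost coefficients of the ideal representation, isolates
the leading Taylor form in `(δ, x)`. -/
theorem HasOrder.exists_form {n : ℕ} : ∀ {k : ℕ} {H : Pt → ℝ}, HasOrder n k H →
    ∃ h, IsForm n k h ∧ HasOrder n (k + 1) fun p => H p - h p
  | 0, H, h => ⟨fun p => H (core p), ⟨IsSymbol.comp h (isEquivariant_core n), fun p => rfl⟩,
      IsSymbol.hasOrder_sub_core h⟩
  | k + 1, H, ⟨A, B, hA, hB, e⟩ => by
    obtain ⟨a, ha, ea⟩ := hA.exists_form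
    obtain ⟨b, hb, eb⟩ := hB.exists_form
    refine ⟨_, ⟨a, b, ha, hb, rfl⟩, ?_⟩
    have := ea.fst_mul.add eb.snd_mul
    rw [e]
    convert this using 2
    ring

/-! ### Bounds uniform in the periodic variables. -/

/-- A symbol is bounded where `δ` and `x` are bounded. -/
theorem IsSymbol.exists_bound {n : ℕ} (hn : 0 < n) {H : Pt → ℝ} (hH : IsSymbol n H) (B : ℝ) :
    ∃ C, 0 ≤ C ∧ ∀ p : Pt, |p.1| ≤ B → |p.2.1| ≤ B → |H p| ≤ C := by
  have hc : IsCompact (Set.Icc (-B) B ×ˢ Set.Icc (-B) B ×ˢ Set.Icc 0 (0 + 2 * Real.pi) ×ˢ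
      Set.Icc 0 (0 + 2 * Real.pi * (n : ℝ)) : Set Pt) :=
    isCompact_Icc.prod (isCompact_Icc.prod (isCompact_Icc.prod isCompact_Icc))
  obtain ⟨C, hC⟩ := hc.exists_bound_of_continuousOn hH.smooth.continuous.continuousOn
  refine ⟨max C 0, le_max_right _ _, ?_⟩
  rintro ⟨d, x, Ψ, S⟩ h1 h2
  have hp1 : Function.Periodic (fun Ψ => H (d, x, Ψ, S)) (2 * Real.pi) := fun Ψ => by
    simpa using hH.periodic _ (Or.inl rfl) (d, x, Ψ, S)
  obtain ⟨Ψ', hΨ', e1⟩ := hp1.exists_mem_Ico Real.two_pi_pos Ψ 0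
  have hp2 : Function.Periodic (fun S => H (d, x, Ψ', S)) (2 * Real.pi * (n : ℝ)) := fun S => by
    simpa using hH.periodic _ (Or.inr rfl) (d, x, Ψ', S)
  have hn' : (0 : ℝ) < n := by exact_mod_cast hn
  obtain ⟨S', hS', e2⟩ := hp2.exists_mem_Ico (by positivity) S 0
  rw [e1, e2]
  refine (hC (d, x, Ψ', S') ⟨abs_le.1 h1, abs_le.1 h2, ⟨hΨ'.1, hΨ'.2.le⟩,
    ⟨hS'.1, hS'.2.le⟩⟩).trans (le_max_left _ _)

theorem HasOrder.exists_bound {n : ℕ} (hn : 0 < n) (B : ℝ) : ∀ {k : ℕ} {H : Pt → ℝ},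
    HasOrder n k H → ∃ C, 0 ≤ C ∧ ∀ p : Pt, |p.1| ≤ B → |p.2.1| ≤ B →
      |H p| ≤ C * (|p.1| + |p.2.1|) ^ k
  | 0, H, h => by simpa using IsSymbol.exists_bound hn h B
  | k + 1, H, ⟨A₁, A₂, h₁, h₂, e⟩ => by
    obtain ⟨C₁, hC₁, H₁⟩ := h₁.exists_bound hn B
    obtain ⟨C₂, hC₂, H₂⟩ := h₂.exists_bound hn B
    refine ⟨C₁ + C₂, by positivity, fun p hp hp' => ?_⟩
    have e1 := H₁ p hp hp'
    have e2 := H₂ p hp hp'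
    set s := |p.1| + |p.2.1| with hs
    have s1 : |p.1| ≤ s := by rw [hs]; linarith [abs_nonneg p.2.1]
    have s2 : |p.2.1| ≤ s := by rw [hs]; linarith [abs_nonneg p.1]
    have s0 : 0 ≤ s := (abs_nonneg _).trans s1
    rw [e]
    calc |p.1 * A₁ p + p.2.1 * A₂ p| ≤ |p.1| * |A₁ p| + |p.2.1| * |A₂ p| := by
          rw [← abs_mul, ← abs_mul]; exact abs_add_le _ _
      _ ≤ s * (C₁ * s ^ k) + s * (C₂ * s ^ k) := by gcongr
      _ = (C₁ + C₂) * s ^ (k + 1) := by ring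

/-! ### Averages over `S` and the homological equation. -/

theorem IsForm.const_mul {n : ℕ} (c : ℝ) : ∀ {k : ℕ} {H : Pt → ℝ}, IsForm n k H →
    IsForm n k fun p => c * H p
  | 0, _, h => ⟨(IsSymbol.const c).mul h.1, fun p => congrArg (c * ·) (h.2 p)⟩
  | _ + 1, _, ⟨_, _, hA, hB, e⟩ =>
    ⟨_, _, hA.const_mul c, hB.const_mul c, by subst e; funext p; ring⟩

theorem dirDeriv_eq_of_hasDerivAt {H : Pt → ℝ} {p v : Pt} {d : ℝ} (hH : DifferentiableAt ℝ H p)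
    (h : HasDerivAt (fun u : ℝ => H (p + u • v)) d 0) : dirDeriv v H p = d := by
  have h1 : HasDerivAt (fun u : ℝ => p + u • v) v 0 := by
    simpa using ((hasDerivAt_id (0 : ℝ)).smul_const v).const_add p
  have h2 : HasFDerivAt H (fderiv ℝ H p) (p + (0 : ℝ) • v) := by simpa using hH.hasFDerivAt
  exact (h2.comp_hasDerivAt (0 : ℝ) h1).unique h

theorem dirDeriv_const_mul {H : Pt → ℝ} {p : Pt} (v : Pt) (c : ℝ)
    (hH : DifferentiableAt ℝ H p) : dirDeriv v (fun p => c * H p) p = c * dirDeriv v H p := by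
  simp only [dirDeriv]
  rw [fderiv_const_mul hH]
  rfl

/-- The mean over `S` of a function of `(Ψ, S)`, and the solution of the homological equation. -/
theorem IsForm.exists_primitive_zero {n : ℕ} (hn : 0 < n) {h : Pt → ℝ} (hh : IsForm n 0 h) :
    IsForm n 0 (fun p => phaseAverage n fun S => h (0, 0, p.2.2.1, S)) ∧
      ∃ P, IsForm n 0 P ∧ ∀ p, dirDeriv (0, 0, 0, 1) P p
        = h p - phaseAverage n fun S => h (0, 0, p.2.2.1, S) := by
  have hs := hh.1.smooth
  have hn' : (0 : ℝ) < n := by exact_mod_cast hn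
  have hT : 0 < 2 * Real.pi * (n : ℝ) := by positivity
  set m : Pt → ℝ := fun p => phaseAverage n fun S => h (0, 0, p.2.2.1, S) with hm
  have hm0 : IsForm n 0 m := by
    refine ⟨⟨?_, ?_⟩, fun p => rfl⟩
    · simp only [hm, phaseAverage]
      refine contDiff_const.mul (contDiff_parametric_intervalIntegral
        (g := fun z : Pt × ℝ => h (0, 0, z.1.2.2.1, z.2)) ?_ _)
      fun_prop
    · rintro w (rfl | rfl) p
      · simp only [hm]
        congr 1
        funext S
        simpa using hh.1.periodic _ (Or.inl rfl) (0, 0, p.2.2.1, S)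
      · simp [hm]
  refine ⟨hm0, ?_⟩
  have hms := hm0.1.smooth
  set k : ℝ → ℝ → ℝ := fun Ψ S => h (0, 0, Ψ, S) - m (0, 0, Ψ, 0) with hk
  have hkc : ∀ Ψ, Continuous (k Ψ) := fun Ψ => by
    have := hs.continuous
    simp only [hk]
    fun_prop
  have hkp : ∀ Ψ, Function.Periodic (k Ψ) (2 * Real.pi * (n : ℝ)) := fun Ψ S => by
    have := hh.1.periodic _ (Or.inr rfl) (0, 0, Ψ, S)
    simpa [hk] using this
  have hk0 : ∀ Ψ, ∫ S in (0 : ℝ)..(2 * Real.pi * (n : ℝ)), k Ψ S = 0 := fun Ψ => by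
    have hi : IntervalIntegrable (fun S => h (0, 0, Ψ, S)) MeasureTheory.volume 0
        (2 * Real.pi * (n : ℝ)) :=
      (hs.continuous.comp (by fun_prop : Continuous fun S : ℝ => ((0, 0, Ψ, S) : Pt)))
        |>.intervalIntegrable _ _
    simp only [hk]
    rw [intervalIntegral.integral_sub hi intervalIntegrable_const,
      intervalIntegral.integral_const]
    simp only [hm, phaseAverage, sub_zero, smul_eq_mul]
    field_simp
    ring
  -- The indefinite integral of the mean-free part is periodic in `S` because its integral over one
  -- period vanishes.
  set P : Pt → ℝ := fun p => ∫ S in (0 : ℝ)..p.2.2.2, k p.2.2.1 S with hP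
  have hPs : ContDiff ℝ ∞ P := by
    -- Rescaling to the fixed interval `[0, 1]` makes the smoothness of parametric integrals
    -- applicable.
    have : P = fun p => p.2.2.2 * ∫ u in (0 : ℝ)..1, k p.2.2.1 (p.2.2.2 * u) := by
      funext p
      rw [intervalIntegral.mul_integral_comp_mul_left]
      simp [hP]
    rw [this]
    refine ContDiff.mul (by fun_prop) (contDiff_parametric_intervalIntegral
        (g := fun z : Pt × ℝ => k z.1.2.2.1 (z.1.2.2.2 * z.2)) ?_ _)
    simp only [hk]
    fun_prop
  have hPp : ∀ w, IsPeriod n w → ∀ p, P (p + w) = P p := by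
    rintro w (rfl | rfl) p
    · simp only [hP]
      have : k (p.2.2.1 + 2 * Real.pi) = k p.2.2.1 := by
        funext S
        have h1 := hh.1.periodic _ (Or.inl rfl) (0, 0, p.2.2.1, S)
        have h2 := hm0.1.periodic _ (Or.inl rfl) (0, 0, p.2.2.1, 0)
        simp only [Prod.mk_add_mk, add_zero] at h1 h2
        simp only [hk, h1, h2]
      simp [this]
    · simp only [hP, Prod.snd_add, Prod.fst_add, add_zero]
      have hi : ∀ a b, IntervalIntegrable (k p.2.2.1) MeasureTheory.volume a b := fun a b =>
        (hkc _).intervalIntegrable _ _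
      rw [← intervalIntegral.integral_add_adjacent_intervals (hi 0 p.2.2.2) (hi _ _),
        (hkp _).intervalIntegral_add_eq p.2.2.2 0, zero_add, hk0, add_zero]
  refine ⟨P, ⟨⟨hPs, hPp⟩, fun p => rfl⟩, fun p => ?_⟩
  refine dirDeriv_eq_of_hasDerivAt (hPs.differentiable (by norm_num) p) ?_
  have h1 : HasDerivAt (fun s : ℝ => ∫ S in (0 : ℝ)..s, k p.2.2.1 S)
      (k p.2.2.1 (p.2.2.2 + 0)) (p.2.2.2 + 0) :=
    intervalIntegral.integral_hasDerivAt_right ((hkc _).intervalIntegrable _ _)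
      ((hkc _).stronglyMeasurableAtFilter _ _) (hkc _).continuousAt
  have h2 := h1.comp_const_add p.2.2.2 0
  rw [hh.2 p]
  simpa [hP, hk, hm, core] using h2

/-- The homological equation for forms. -/
theorem IsForm.exists_primitive {n : ℕ} (hn : 0 < n) (c : ℝ) : ∀ {k : ℕ} {h : Pt → ℝ},
    IsForm n k h → ∃ m P, IsForm n k m ∧ IsForm n k P ∧
      (∀ δ x Ψ S, m (δ, x, Ψ, S) = m (δ, x, Ψ, 0)) ∧
      ∀ p, dirDeriv (0, 0, 0, 1) P p = c * (m p - h p)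
  | 0, h, hh => by
    obtain ⟨hm, P, hP, e⟩ := hh.exists_primitive_zero hn
    refine ⟨_, fun p => -c * P p, hm, hP.const_mul _, fun _ _ _ _ => rfl, fun p => ?_⟩
    rw [dirDeriv_const_mul _ _ (hP.1.differentiableAt p), e p]
    ring
  | k + 1, h, ⟨A, B, hA, hB, e⟩ => by
    obtain ⟨m₁, P₁, hm₁, hP₁, i₁, e₁⟩ := hA.exists_primitive hn c
    obtain ⟨m₂, P₂, hm₂, hP₂, i₂, e₂⟩ := hB.exists_primitive hn c
    refine ⟨_, _, ⟨m₁, m₂, hm₁, hm₂, rfl⟩, ⟨P₁, P₂, hP₁, hP₂, rfl⟩, fun δ x Ψ S => ?_,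
      fun p => ?_⟩
    · simp only [i₁ δ x Ψ S, i₂ δ x Ψ S]
    · rw [dirDeriv_coords _ (hP₁.hasOrder.isSymbol.differentiableAt p)
        (hP₂.hasOrder.isSymbol.differentiableAt p), e₁, e₂, e]
      ring

/-! ### Derivatives along the flow and the averaging step. -/

/-- The derivative of `H(δ, x, Ψ, S)` along the flow `δ' = -δ^{2q+1}/(2q)`, `x' = δ² F`,
`Ψ' = G`, `S' = s₀ + σ`. -/
noncomputable def transport (q : ℕ) (s₀ : ℝ) (σ F G H : Pt → ℝ) (p : Pt) : ℝ :=
  -(1 / (2 * (q : ℝ))) * (p.1 ^ (2 * q + 1) * dirDeriv (1, 0, 0, 0) H p)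
    + p.1 ^ 2 * F p * dirDeriv (0, 1, 0, 0) H p + G p * dirDeriv (0, 0, 1, 0) H p
    + (s₀ + σ p) * dirDeriv (0, 0, 0, 1) H p

/-- The derivative of `x / δ + δ P` along the flow, divided by `δ`. -/
noncomputable def radialRate (q : ℕ) (s₀ : ℝ) (σ F G P : Pt → ℝ) (p : Pt) : ℝ :=
  F p + 1 / (2 * (q : ℝ)) * (p.1 ^ (2 * (q - 1)) * p.2.1) + transport q s₀ σ F G P p
    - 1 / (2 * (q : ℝ)) * (p.1 ^ (2 * q) * P p)

/-- The derivative of `Ψ + Q` along the flow. -/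
noncomputable def angularRate (q : ℕ) (s₀ : ℝ) (σ F G Q : Pt → ℝ) (p : Pt) : ℝ :=
  G p + transport q s₀ σ F G Q p

/-- The shear that corresponds to `R ↦ R + δ P`, `Ψ ↦ Ψ + Q` for `x = δ R`. -/
def nearIdentity (P Q : Pt → ℝ) : Pt → Pt := shear (fun p => p.1 ^ 2 * P p) Q

section Averaging

variable {n q : ℕ} {s₀ : ℝ} {σ : Pt → ℝ}

/-- All terms except `s₀ ∂_S` gain an order: `δ ∂_δ` preserves the order and comes with `δ^{2q}`, `δ
∂_x` preserves it and comes with `δ F`, and `∂_Ψ`, `∂_S` preserve it and come with `G`, `σ` of order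
one. -/
theorem hasOrder_transport (hq : 1 ≤ q) (hσ : HasOrder n 1 σ) {F G : Pt → ℝ}
    (hF : IsSymbol n F) (hG : HasOrder n 1 G) {k : ℕ} {H : Pt → ℝ} (hH : HasOrder n k H) :
    HasOrder n (k + 1) fun p => transport q s₀ σ F G H p - s₀ * dirDeriv (0, 0, 0, 1) H p := by
  have h1 : HasOrder n (k + 1) fun p => -(1 / (2 * (q : ℝ))) *
      (p.1 ^ (2 * q) * (p.1 * dirDeriv (1, 0, 0, 0) H p)) :=
    (((hH.fst_mul_dirDeriv (1, 0, 0, 0)).fst_pow_mul (2 * q)).mono (by omega)).const_mul _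
  have h2 := (HasOrder.symbol_mul hF (hH.fst_mul_dirDeriv (0, 1, 0, 0))).fst_mul
  have h3 := hG.mul (hH.dirDeriv_of_core (v := (0, 0, 1, 0)) rfl rfl)
  have h4 := hσ.mul (hH.dirDeriv_of_core (v := (0, 0, 0, 1)) rfl rfl)
  rw [add_comm 1 k] at h3 h4
  convert ((h1.add h2).add h3).add h4 using 2
  simp only [transport]
  ring

theorem transport_add {F G H K : Pt → ℝ} (hH : IsSymbol n H) (hK : IsSymbol n K) (p : Pt) :
    transport q s₀ σ F G (fun p => H p + K p) p
      = transport q s₀ σ F G H p + transport q s₀ σ F G K p := by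
  simp only [transport, dirDeriv_add _ (hH.differentiableAt p) (hK.differentiableAt p)]
  ring

theorem transport_sub_transport {F G F' G' H : Pt → ℝ} (p : Pt) :
    transport q s₀ σ F' G' H p - transport q s₀ σ F G H p
      = p.1 ^ 2 * (F' p - F p) * dirDeriv (0, 1, 0, 0) H p
        + (G' p - G p) * dirDeriv (0, 0, 1, 0) H p := by
  simp only [transport]
  ring

/-- The fields enter affinely and undifferentiated, so pointwise bounds on their difference suffice
to compare the rates. -/
theorem radialRate_sub_radialRate {F G F' G' H : Pt → ℝ} (p : Pt) :
    radialRate q s₀ σ F' G' H p - radialRate q s₀ σ F G H p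
      = (F' p - F p) + (p.1 ^ 2 * (F' p - F p) * dirDeriv (0, 1, 0, 0) H p
        + (G' p - G p) * dirDeriv (0, 0, 1, 0) H p) := by
  rw [← transport_sub_transport (q := q) (s₀ := s₀) (σ := σ)]
  simp only [radialRate]
  ring

theorem angularRate_sub_angularRate {F G F' G' H : Pt → ℝ} (p : Pt) :
    angularRate q s₀ σ F' G' H p - angularRate q s₀ σ F G H p
      = (G' p - G p) + (p.1 ^ 2 * (F' p - F p) * dirDeriv (0, 1, 0, 0) H p
        + (G' p - G p) * dirDeriv (0, 0, 1, 0) H p) := by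
  rw [← transport_sub_transport (q := q) (s₀ := s₀) (σ := σ)]
  simp only [angularRate]
  ring

theorem hasOrder_radialRate_sub {F G F' G' P : Pt → ℝ} (hP : IsSymbol n P) {k : ℕ}
    (hF : HasOrder n k fun p => F' p - F p) (hG : HasOrder n k fun p => G' p - G p) :
    HasOrder n k fun p => radialRate q s₀ σ F' G' P p - radialRate q s₀ σ F G P p := by
  simp only [radialRate_sub_radialRate]
  refine hF.add (HasOrder.add ?_ ?_)
  · have := HasOrder.symbol_mul ((IsSymbol.fst.pow 2).mul (hP.directional (0, 1, 0, 0))) hF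
    convert this using 2
    ring
  · have := HasOrder.symbol_mul (hP.directional (0, 0, 1, 0)) hG
    convert this using 2
    ring

theorem hasOrder_angularRate_sub {F G F' G' Q : Pt → ℝ} (hQ : IsSymbol n Q) {k : ℕ}
    (hF : HasOrder n k fun p => p.1 ^ 2 * (F' p - F p))
    (hG : HasOrder n k fun p => G' p - G p) :
    HasOrder n k fun p => angularRate q s₀ σ F' G' Q p - angularRate q s₀ σ F G Q p := by
  simp only [angularRate_sub_angularRate]
  refine hG.add (HasOrder.add ?_ ?_)
  · have := HasOrder.symbol_mul (hQ.directional (0, 1, 0, 0)) hF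
    convert this using 2
    ring
  · have := HasOrder.symbol_mul (hQ.directional (0, 0, 1, 0)) hG
    convert this using 2
    ring

/-- Two effects are of order `l + 1`. Inside `L` the arguments move by `δ² p` in `x` and by `r` in
`Ψ`, of orders `k + 2` and `k + 1`. For `m`, the near-identity map differs from the identity by
order two in `x` and order one in `Ψ`. -/
theorem HasOrder.comp_nearIdentity_add {P Q L p r m : Pt → ℝ} (hP : IsSymbol n P)
    (hQ : HasOrder n 1 Q) {i k l : ℕ} (hL : HasOrder n i L) (hp : HasOrder n k p)
    (hr : HasOrder n (k + 1) r) (hm : HasOrder n l m) (hl : l = i + k) :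
    HasOrder n (l + 1) fun z => L (nearIdentity (fun z => P z + p z) (fun z => Q z + r z) z)
      + m (nearIdentity (fun z => P z + p z) (fun z => Q z + r z) z)
      - L (nearIdentity P Q z) - m z := by
  subst hl
  have hP' := hP.add hp.isSymbol
  have hQ' : HasOrder n 1 fun z => Q z + r z := hQ.add (hr.mono (by omega))
  have a1 : HasOrder n 2 fun z => z.1 ^ 2 * P z := by
    have := HasOrder.fst_pow_mul (k := 0) hP 2
    simpa using this
  have a2 : HasOrder n 2 fun z => z.1 ^ 2 * (P z + p z) := by
    have := HasOrder.fst_pow_mul (k := 0) hP' 2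
    simpa using this
  have i1 := HasOrder.comp_shear_sub (m := k + 1) a1.pred hQ.isSymbol a2.pred hQ'.isSymbol
    ((hp.fst_pow_mul 2).congr fun z => by ring) (hr.congr fun z => by ring) hL
  have i2 := HasOrder.comp_shear_sub (m := 1) (HasOrder.zero 1) (IsSymbol.const 0) a2.pred
    hQ'.isSymbol (a2.congr fun z => by ring) (hQ'.congr fun z => by ring) hm
  refine (i1.add i2).congr fun z => ?_
  simp only [nearIdentity, shear_zero]
  ring

/-- One step of the averaging procedure. -/
theorem averaging_step (hq : 1 ≤ q) (hσ : HasOrder n 1 σ) {F G : Pt → ℝ}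
    (hF : IsSymbol n F) (hG : HasOrder n 1 G) {P Q L W h j p r m w : Pt → ℝ} {k : ℕ}
    (hP : IsSymbol n P) (hQ : HasOrder n 1 Q) (hL : IsSymbol n L) (hW : HasOrder n 1 W)
    (hE : HasOrder n (k + 1)
      fun z => radialRate q s₀ σ F G P z - L (nearIdentity P Q z) - h z)
    (hE' : HasOrder n (k + 2)
      fun z => angularRate q s₀ σ F G Q z - W (nearIdentity P Q z) - j z)
    (hp : HasOrder n k p) (hr : HasOrder n (k + 1) r) (hm : HasOrder n k m)
    (hw : HasOrder n (k + 1) w)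
    (ep : ∀ z, s₀ * dirDeriv (0, 0, 0, 1) p z = m z - h z)
    (er : ∀ z, s₀ * dirDeriv (0, 0, 0, 1) r z = w z - j z) :
    HasOrder n (k + 1) (fun z => radialRate q s₀ σ F G (fun z => P z + p z) z
      - (L (nearIdentity (fun z => P z + p z) (fun z => Q z + r z) z)
        + m (nearIdentity (fun z => P z + p z) (fun z => Q z + r z) z))) ∧
    HasOrder n (k + 2) (fun z => angularRate q s₀ σ F G (fun z => Q z + r z) z
      - (W (nearIdentity (fun z => P z + p z) (fun z => Q z + r z) z)
        + w (nearIdentity (fun z => P z + p z) (fun z => Q z + r z) z))) := by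
  constructor
  -- To leading order, adding `p` changes the rate by `s₀ ∂_S p = m - h`, which trades `h` for `m`.
  -- What is left, `i1`, `i2` and `i3`, lies one order higher.
  · have i1 := HasOrder.comp_nearIdentity_add (i := 0) hP hQ hL hp hr hm (by omega)
    have i2 := hasOrder_transport (s₀ := s₀) hq hσ hF hG hp
    have i3 : HasOrder n (k + 1) fun z => 1 / (2 * (q : ℝ)) * (z.1 ^ (2 * q) * p z) :=
      ((hp.fst_pow_mul (2 * q)).mono (by omega)).const_mul _
    refine (((hE.add i2).sub i3).sub i1).congr fun z => ?_
    have := ep z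
    simp only [radialRate, transport_add hP hp.isSymbol]
    linear_combination this
  · have i1 := HasOrder.comp_nearIdentity_add (i := 1) hP hQ hW hp hr hw (by omega)
    have i2 := hasOrder_transport (s₀ := s₀) hq hσ hF hG hr
    refine ((hE'.add i2).sub i1).congr fun z => ?_
    have := er z
    simp only [angularRate, transport_add hQ.isSymbol hr.isSymbol]
    linear_combination this

end Averaging

/-! ### Averaging to all orders. -/

theorem exists_seq_of_forall_exists_step {X : Type*} {A : ℕ → X → Prop} {R : ℕ → X → X → Prop}
    {x₀ : X} (h₀ : A 0 x₀) (step : ∀ i x, A i x → ∃ y, A (i + 1) y ∧ R i x y) :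
    ∃ f : ℕ → X, f 0 = x₀ ∧ ∀ i, A i (f i) ∧ R i (f i) (f (i + 1)) := by
  choose! next hnext using step
  let f : ℕ → X := fun i => Nat.rec x₀ (fun i x => next i x) i
  have hA : ∀ i, A i (f i) := fun i => by
    induction i with
    | zero => exact h₀
    | succ i ih => exact (hnext i _ ih).1
  exact ⟨f, rfl, fun i => ⟨hA i, (hnext i _ (hA i)).2⟩⟩

theorem HasOrder.sub_of_step {n : ℕ} {F : ℕ → Pt → ℝ} {d : ℕ → ℕ} (hd : Monotone d)
    (hF : ∀ M, HasOrder n (d M) fun p => F (M + 1) p - F M p) {M M' : ℕ} (h : M ≤ M') :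
    HasOrder n (d M) fun p => F M' p - F M p := by
  induction M', h using Nat.le_induction with
  | base => simpa using HasOrder.zero (d M)
  | succ M' hM ih =>
    exact (((hF M').mono (hd hM)).add ih).congr fun p => by ring

/-- The expansion of a sequence of functions that agree to higher and higher order. -/
theorem HasOrder.exists_expansion {n k : ℕ} {Z : ℕ → Pt → ℝ} (h0 : HasOrder n k (Z 0))
    (hZ : ∀ i, HasOrder n (k + i + 1) fun p => Z (i + 1) p - Z i p) :
    ∃ c : ℕ → Pt → ℝ, (∀ i, IsForm n (k + i) (c i)) ∧
      ∀ i, HasOrder n (k + i) fun p => Z i p - ∑ j ∈ Finset.range i, c j p := by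
  -- The state `T` is the partial sum. Each step adds the leading form of `Z i - T`, which is not
  -- affected by the passage from `Z i` to `Z (i + 1)`.
  obtain ⟨f, hf0, hf⟩ := exists_seq_of_forall_exists_step (X := Pt → ℝ)
    (A := fun i T => HasOrder n (k + i) fun p => Z i p - T p)
    (R := fun i T T' => IsForm n (k + i) fun p => T' p - T p) (x₀ := fun _ => 0)
    (by simpa using h0) (fun i T hT => by
      obtain ⟨h, hh, e⟩ := hT.exists_form
      exact ⟨fun p => T p + h p, (e.add (hZ i)).congr fun p => by ring, by simpa using hh⟩)
  refine ⟨fun i p => f (i + 1) p - f i p, fun i => (hf i).2, fun i => ?_⟩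
  refine (hf i).1.congr fun p => ?_
  rw [Finset.sum_range_sub (fun i => f i p), hf0]
  ring

section Averaging

variable {n q : ℕ} {s₀ : ℝ} {σ : Pt → ℝ}

theorem transport_zero {F G : Pt → ℝ} (p : Pt) : transport q s₀ σ F G (fun _ => 0) p = 0 := by
  simp [transport, dirDeriv]

/-- The averaging procedure to all orders. -/
theorem exists_averaging (hn : 0 < n) (hq : 1 ≤ q) (hs : s₀ ≠ 0) (hσ : HasOrder n 1 σ)
    {F G : ℕ → Pt → ℝ} (hF : ∀ M, IsSymbol n (F M)) (hG : ∀ M, HasOrder n 1 (G M))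
    (hF' : ∀ M, HasOrder n (2 * M) fun p => F (M + 1) p - F M p)
    (hG' : ∀ M, HasOrder n (2 * M + 2) fun p => G (M + 1) p - G M p)
    {h₀ : Pt → ℝ} (hh₀ : IsForm n 0 h₀) (hFh : ∀ M, 1 ≤ M → HasOrder n 1 fun p => F M p - h₀ p)
    {η : ℝ} (hGη : ∀ M, 1 ≤ M → HasOrder n 2 fun p => G M p - η * p.2.1) :
    ∃ lam om : ℕ → Pt → ℝ, (∀ k, IsForm n k (lam k)) ∧ (∀ k, IsForm n (k + 1) (om k)) ∧
      (∀ k δ x Ψ S, lam k (δ, x, Ψ, S) = lam k (δ, x, Ψ, 0) ∧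
        om k (δ, x, Ψ, S) = om k (δ, x, Ψ, 0)) ∧
      (∀ p, lam 0 p = phaseAverage n fun S => h₀ (0, 0, p.2.2.1, S)) ∧
      (∀ p, om 0 p = η * p.2.1) ∧
      ∀ N, 1 ≤ N → ∃ P Q, IsSymbol n P ∧ HasOrder n 2 Q ∧ ∀ M, N ≤ M →
        HasOrder n N (fun p => radialRate q s₀ σ (F M) (G M) P p
          - ∑ k ∈ Finset.range N, lam k (nearIdentity P Q p)) ∧
        HasOrder n (N + 1) (fun p => angularRate q s₀ σ (F M) (G M) Q p
          - ∑ k ∈ Finset.range N, om k (nearIdentity P Q p)) := by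
  have hFge : ∀ {M M' : ℕ}, M ≤ M' → HasOrder n (2 * M) fun p => F M' p - F M p :=
    fun h => HasOrder.sub_of_step (d := fun M => 2 * M) (fun a b hab => by
      change 2 * a ≤ 2 * b; omega) hF' h
  have hGge : ∀ {M M' : ℕ}, M ≤ M' → HasOrder n (2 * M + 2) fun p => G M' p - G M p :=
    fun h => HasOrder.sub_of_step (d := fun M => 2 * M + 2) (fun a b hab => by
      change 2 * a + 2 ≤ 2 * b + 2; omega) hG' h
  obtain ⟨hm₀, P₀, hP₀, e₀⟩ := hh₀.exists_primitive_zero hn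
  set m₀ : Pt → ℝ := fun p => phaseAverage n fun S => h₀ (0, 0, p.2.2.1, S) with hm₀def
  have hx : IsForm n 1 fun p : Pt => η * p.2.1 :=
    ⟨_, fun _ => η, IsForm.zero 0, ⟨IsSymbol.const η, fun _ => rfl⟩, by funext p; ring⟩
  -- The state is `(P, Q, L, W)`: the corrections and the averaged right-hand sides accumulated so
  -- far, valid for all truncations `M ≥ i + 1` simultaneously.
  obtain ⟨f, hf0, hf⟩ := exists_seq_of_forall_exists_step
    (X := (Pt → ℝ) × (Pt → ℝ) × (Pt → ℝ) × (Pt → ℝ))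
    (A := fun i X => IsSymbol n X.1 ∧ HasOrder n 2 X.2.1 ∧ IsSymbol n X.2.2.1 ∧
      HasOrder n 1 X.2.2.2 ∧ ∀ M, i + 1 ≤ M →
        HasOrder n (i + 1) (fun p => radialRate q s₀ σ (F M) (G M) X.1 p
          - X.2.2.1 (nearIdentity X.1 X.2.1 p)) ∧
        HasOrder n (i + 2) (fun p => angularRate q s₀ σ (F M) (G M) X.2.1 p
          - X.2.2.2 (nearIdentity X.1 X.2.1 p)))
    (R := fun i X Y => ∃ m w, IsForm n (i + 1) m ∧ IsForm n (i + 2) w ∧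
      (∀ δ x Ψ S, m (δ, x, Ψ, S) = m (δ, x, Ψ, 0)) ∧
      (∀ δ x Ψ S, w (δ, x, Ψ, S) = w (δ, x, Ψ, 0)) ∧
      (∀ p, Y.2.2.1 p = X.2.2.1 p + m p) ∧ ∀ p, Y.2.2.2 p = X.2.2.2 p + w p)
    -- The first averaging is already done in the initial state. The angular correction starts at
    -- zero because `η x` does not depend on `S`; this is why `Q` has order two throughout.
    (x₀ := (fun p => 0 + -s₀⁻¹ * P₀ p, fun _ => 0 + 0, m₀, fun p => η * p.2.1))
    ⟨(IsSymbol.const 0).add (hP₀.const_mul _).1, by simpa using HasOrder.zero 2, hm₀.1,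
      hx.hasOrder, fun M hM => by
        have := averaging_step (s₀ := s₀) (P := fun _ => 0) (Q := fun _ => 0) (L := fun _ => 0)
          (W := fun _ => 0) (h := h₀) (j := fun p => η * p.2.1) (p := fun p => -s₀⁻¹ * P₀ p)
          (r := fun _ => 0) (m := m₀) (w := fun p => η * p.2.1) (k := 0) hq hσ (hF M) (hG M)
          (IsSymbol.const 0) (HasOrder.zero 1) (IsSymbol.const 0) (HasOrder.zero 1)
          (by
            have h1 : HasOrder n 1 fun p : Pt =>
                1 / (2 * (q : ℝ)) * (p.1 ^ (2 * (q - 1)) * p.2.1) :=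
              ((HasOrder.snd.fst_pow_mul _).mono (by omega)).const_mul _
            refine ((hFh M hM).add h1).congr fun p => ?_
            simp only [radialRate, transport_zero]
            ring)
          (by
            refine (hGη M hM).congr fun p => ?_
            simp only [angularRate, transport_zero]
            ring)
          (hP₀.const_mul _).hasOrder (HasOrder.zero _) hm₀.hasOrder hx.hasOrder
          (fun z => by
            rw [dirDeriv_const_mul _ _ (hP₀.1.differentiableAt z), e₀ z]
            field_simp
            ring)
          (fun z => by simp [dirDeriv])
        simpa only [zero_add] using this⟩
    (by
      rintro i ⟨P, Q, L, W⟩ ⟨hP, hQ, hL, hW, hE⟩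
      simp only at hP hQ hL hW hE
      -- The forms to be removed are read off from the truncation `i + 2`. For larger `M` the error
      -- changes only by terms beyond the order treated, so the same `p` and `r` serve every `M ≥ i
      -- + 2`.
      obtain ⟨hE₁, hE₂⟩ := hE (i + 2) (by omega)
      obtain ⟨h, hh, eh⟩ := hE₁.exists_form
      obtain ⟨j, hj, ej⟩ := hE₂.exists_form
      obtain ⟨m, p, hm, hp, im, ep⟩ := hh.exists_primitive hn s₀⁻¹
      obtain ⟨w, r, hw, hr, iw, er⟩ := hj.exists_primitive hn s₀⁻¹
      refine ⟨(fun z => P z + p z, fun z => Q z + r z, fun z => L z + m z, fun z => W z + w z),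
        ⟨hP.add hp.hasOrder.isSymbol, hQ.add (hr.hasOrder.mono (by omega)),
          hL.add hm.hasOrder.isSymbol, hW.add (hw.hasOrder.mono (by omega)), fun M hM => ?_⟩,
        m, w, hm, hw, im, iw, fun _ => rfl, fun _ => rfl⟩
      refine averaging_step (k := i + 1) (h := h) (j := j) hq hσ (hF M) (hG M) hP hQ.pred hL hW
        ?_ ?_ hp.hasOrder hr.hasOrder hm.hasOrder hw.hasOrder (fun z => ?_) (fun z => ?_)
      · have := hasOrder_radialRate_sub (q := q) (s₀ := s₀) (σ := σ) hP
          ((hFge hM).mono (by omega : i + 2 ≤ _)) ((hGge hM).mono (by omega : i + 2 ≤ _))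
        exact (eh.add this).congr fun p => by ring
      · have := hasOrder_angularRate_sub (q := q) (s₀ := s₀) (σ := σ) hQ.isSymbol
          (((hFge hM).fst_pow_mul 2).mono (by omega : i + 3 ≤ _))
          ((hGge hM).mono (by omega : i + 3 ≤ _))
        exact (ej.add this).congr fun p => by ring
      · rw [ep z]; field_simp
      · rw [er z]; field_simp)
  -- Taken as increments of `L` and `W`, the forms `lam` and `om` have telescoping sums.
  refine ⟨fun k => Nat.casesOn k (f 0).2.2.1 fun k p => (f (k + 1)).2.2.1 p - (f k).2.2.1 p,
    fun k => Nat.casesOn k (f 0).2.2.2 fun k p => (f (k + 1)).2.2.2 p - (f k).2.2.2 p,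
    ?_, ?_, ?_, ?_, ?_, ?_⟩
  · rintro (_ | k)
    · rw [hf0]; exact hm₀
    · obtain ⟨m, w, hm, hw, im, iw, e1, e2⟩ := (hf k).2
      simpa [e1] using hm
  · rintro (_ | k)
    · rw [hf0]; exact hx
    · obtain ⟨m, w, hm, hw, im, iw, e1, e2⟩ := (hf k).2
      simpa [e2] using hw
  · rintro (_ | k) δ x Ψ S
    · rw [hf0]; exact ⟨rfl, rfl⟩
    · obtain ⟨m, w, hm, hw, im, iw, e1, e2⟩ := (hf k).2
      simp only [e1, e2, add_sub_cancel_left]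
      exact ⟨im δ x Ψ S, iw δ x Ψ S⟩
  · intro p; rw [hf0]; rfl
  · intro p; rw [hf0]; rfl
  · rintro (_ | N) hN
    · omega
    obtain ⟨hP, hQ, -, -, hE⟩ := (hf N).1
    refine ⟨_, _, hP, hQ, fun M hM => ⟨(hE M hM).1.congr fun p => ?_,
      (hE M hM).2.congr fun p => ?_⟩⟩
    · rw [Finset.sum_range_succ']
      simp only
      rw [Finset.sum_range_sub (fun k => (f k).2.2.1 (nearIdentity (f N).1 (f N).2.1 p))]
      change _ - (_ + (f 0).2.2.1 _) = _
      ring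
    · rw [Finset.sum_range_succ']
      simp only
      rw [Finset.sum_range_sub (fun k => (f k).2.2.2 (nearIdentity (f N).1 (f N).2.1 p))]
      change _ - (_ + (f 0).2.2.2 _) = _
      ring

end Averaging

/-! ### Cut-offs and global inversion of shears. -/

/-- Smooth cut-offs `x ↦ x χ(x)` of the identity, Lipschitz with a uniform constant. -/
theorem exists_cutoff : ∃ K : ℝ, 0 < K ∧ ∀ c : ℝ, 0 < c → ∃ χ : ℝ → ℝ, ContDiff ℝ ∞ χ ∧
    (∀ x, |x| ≤ c → χ x = 1) ∧ (∀ x, |x * χ x| ≤ 2 * c) ∧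
    ∀ x y, |x * χ x - y * χ y| ≤ K * |x - y| := by
  -- A single bump is rescaled: `x χ(x) = c g(x / c)` with `g(y) = y b(y)`, so the Lipschitz
  -- constant does not depend on `c`.
  let b : ContDiffBump (0 : ℝ) := ⟨1, 2, one_pos, one_lt_two⟩
  have hb : ContDiff ℝ ∞ (b : ℝ → ℝ) := b.contDiff
  have hlip := (contDiff_id.mul (hb.of_le (by exact_mod_cast le_top)) :
    ContDiff ℝ 1 (id * (b : ℝ → ℝ))).lipschitzWith_of_hasCompactSupport
      (b.hasCompactSupport.mul_left) one_ne_zero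
  obtain ⟨K, hK⟩ := hlip
  refine ⟨K + 1, by positivity, fun c hc => ⟨fun x => b (x / c), by fun_prop, ?_, ?_, ?_⟩⟩
  · intro x hx
    refine b.one_of_mem_closedBall ?_
    simp only [Metric.mem_closedBall, dist_zero_right, Real.norm_eq_abs, abs_div, abs_of_pos hc]
    exact (div_le_one hc).2 hx
  · intro x
    rw [abs_mul, abs_of_nonneg b.nonneg]
    by_cases hx : |x| ≤ 2 * c
    · calc |x| * b (x / c) ≤ |x| * 1 := by gcongr; exact b.le_one
        _ ≤ 2 * c := by linarith
    · rw [b.zero_of_le_dist, mul_zero]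
      · positivity
      · simp only [dist_zero_right, Real.norm_eq_abs, abs_div, abs_of_pos hc]
        exact (le_div_iff₀ hc).2 (not_le.1 hx).le
  · intro x y
    have h := hK.dist_le_mul (x / c) (y / c)
    simp only [Real.dist_eq, Pi.mul_apply, id] at h
    have e1 : x * b (x / c) - y * b (y / c)
        = c * (x / c * b (x / c) - y / c * b (y / c)) := by field_simp
    have e2 : |x - y| = c * |x / c - y / c| := by
      rw [← abs_of_pos hc, ← abs_mul, abs_of_pos hc]
      congr 1
      field_simp
    rw [e1, abs_mul, abs_of_pos hc, e2]
    calc c * |x / c * b (x / c) - y / c * b (y / c)| ≤ c * (K * |x / c - y / c|) := by gcongr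
      _ ≤ (K + 1) * (c * |x / c - y / c|) := by
        have : 0 ≤ c * |x / c - y / c| := by positivity
        linarith

/-- The truncation `(δ, x, Ψ, S) ↦ (δ χ(δ), x χ(x), Ψ, S)`. -/
def truncate (χ : ℝ → ℝ) (p : Pt) : Pt := (p.1 * χ p.1, p.2.1 * χ p.2.1, p.2.2.1, p.2.2.2)

theorem isEquivariant_truncate {n : ℕ} {χ : ℝ → ℝ} (hχ : ContDiff ℝ ∞ χ) :
    IsEquivariant n (truncate χ) := by
  refine ⟨by unfold truncate; fun_prop, fun w hw p => ?_⟩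
  ext <;> simp [truncate, hw.fst_eq, hw.snd_eq]

theorem HasOrder.comp_truncate {n : ℕ} {χ : ℝ → ℝ} (hχ : ContDiff ℝ ∞ χ) {k : ℕ} {H : Pt → ℝ}
    (h : HasOrder n k H) : HasOrder n k fun p => H (truncate χ p) := by
  refine HasOrder.comp (isEquivariant_truncate hχ) ?_ ?_ h
  · exact HasOrder.fst_mul (k := 0) (H := fun p => χ p.1)
      ⟨by fun_prop, fun w hw p => by simp [hw.fst_eq]⟩
  · exact HasOrder.snd_mul (k := 0) (H := fun p => χ p.2.1)
      ⟨by fun_prop, fun w hw p => by simp [hw.snd_eq]⟩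

theorem HasOrder.eq_zero {n k : ℕ} {H : Pt → ℝ} (h : HasOrder n (k + 1) H) (Ψ S : ℝ) :
    H (0, 0, Ψ, S) = 0 := by
  obtain ⟨A, B, -, -, rfl⟩ := h
  simp

/-- Near `δ = x = 0`, a function of order two is Lipschitz with a small constant. -/
theorem HasOrder.exists_lipschitz {n : ℕ} (hn : 0 < n) {α : Pt → ℝ} (hα : HasOrder n 2 α) :
    ∃ C, 0 ≤ C ∧ ∀ c, c ≤ 1 → ∀ p p' : Pt, |p.1| ≤ c → |p.2.1| ≤ c → |p'.1| ≤ c → |p'.2.1| ≤ c →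
      |α p - α p'| ≤ C * c * ‖p - p'‖ := by
  have hb := fun v : Pt => (hα.dirDeriv_pred v).exists_bound hn 1
  choose C hC hb using hb
  set K := C (1, 0, 0, 0) + C (0, 1, 0, 0) + C (0, 0, 1, 0) + C (0, 0, 0, 1) with hK
  have hK0 : 0 ≤ K := by
    have := hC (1, 0, 0, 0); have := hC (0, 1, 0, 0); have := hC (0, 0, 1, 0)
    have := hC (0, 0, 0, 1); positivity
  refine ⟨2 * K, by positivity, fun c hc p p' h1 h2 h3 h4 => ?_⟩
  have hconv : Convex ℝ (Set.Icc (-c) c ×ˢ Set.Icc (-c) c ×ˢ Set.univ : Set Pt) :=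
    (convex_Icc _ _).prod ((convex_Icc _ _).prod convex_univ)
  have hc0 : 0 ≤ c := (abs_nonneg _).trans h1
  -- The first derivatives have order one, hence are `O(c)` on the convex box.
  have hbound : ∀ z ∈ (Set.Icc (-c) c ×ˢ Set.Icc (-c) c ×ˢ Set.univ : Set Pt),
      ‖fderiv ℝ α z‖ ≤ 2 * K * c := by
    rintro z ⟨hz1, hz2, -⟩
    have z1 : |z.1| ≤ c := abs_le.2 hz1
    have z2 : |z.2.1| ≤ c := abs_le.2 hz2
    refine ContinuousLinearMap.opNorm_le_bound _ (by positivity) fun v => ?_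
    have hd : ∀ w : Pt, |dirDeriv w α z| ≤ C w * (2 * c) := fun w =>
      (hb w z (z1.trans hc) (z2.trans hc)).trans (by
        have := hC w
        rw [pow_one]; gcongr; linarith)
    have n1 : |v.1| ≤ ‖v‖ := norm_fst_le v
    have n2 : |v.2.1| ≤ ‖v‖ := (norm_fst_le v.2).trans (norm_snd_le v)
    have n3 : |v.2.2.1| ≤ ‖v‖ := (norm_fst_le v.2.2).trans
      ((norm_snd_le v.2).trans (norm_snd_le v))
    have n4 : |v.2.2.2| ≤ ‖v‖ := (norm_snd_le v.2.2).trans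
      ((norm_snd_le v.2).trans (norm_snd_le v))
    rw [fderiv_eq_sum_dirDeriv, Real.norm_eq_abs]
    refine (abs_add_le _ _).trans ((add_le_add_left ((abs_add_le _ _).trans
      (add_le_add_left (abs_add_le _ _) _)) _).trans ?_)
    simp only [abs_mul]
    calc _ ≤ ‖v‖ * (C (1, 0, 0, 0) * (2 * c)) + ‖v‖ * (C (0, 1, 0, 0) * (2 * c))
          + ‖v‖ * (C (0, 0, 1, 0) * (2 * c)) + ‖v‖ * (C (0, 0, 0, 1) * (2 * c)) := by
          gcongr <;> apply hd
      _ = 2 * K * c * ‖v‖ := by rw [hK]; ring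
  have := hconv.norm_image_sub_le_of_norm_fderiv_le (f := α) (𝕜 := ℝ)
    (fun z _ => hα.isSymbol.differentiableAt z) hbound
    (x := p') (y := p) ⟨abs_le.1 h3, abs_le.1 h4, trivial⟩ ⟨abs_le.1 h1, abs_le.1 h2, trivial⟩
  simpa using this

/-- Since `f - id` is a contraction, `f` is a homeomorphism of the whole space. Its derivative
differs from the identity by norm at most `1/2`, so a Neumann series inverts it and the inverse map
is smooth. -/
theorem exists_homeomorph_of_lipschitz_sub_id {E : Type} [NormedAddCommGroup E] [NormedSpace ℝ E]
    [CompleteSpace E] [Nontrivial E] {f : E → E} (hf : ContDiff ℝ ∞ f)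
    (hlip : ∀ x y, ‖f x - f y - (x - y)‖ ≤ 1 / 2 * ‖x - y‖) :
    ∃ g : E → E, ContDiff ℝ ∞ g ∧ (∀ x, g (f x) = x) ∧ ∀ x, f (g x) = x := by
  have happ : ApproximatesLinearOn f ((ContinuousLinearEquiv.refl ℝ E : E ≃L[ℝ] E) : E →L[ℝ] E)
      Set.univ (1 / 2 : NNReal) := fun x _ y _ => by simpa using hlip x y
  have hN : Subsingleton E ∨ (1 / 2 : NNReal) <
      ‖(((ContinuousLinearEquiv.refl ℝ E).symm : E ≃L[ℝ] E) : E →L[ℝ] E)‖₊⁻¹ := by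
    right
    have : ‖(((ContinuousLinearEquiv.refl ℝ E).symm : E ≃L[ℝ] E) : E →L[ℝ] E)‖₊ = 1 := by
      ext
      exact ContinuousLinearMap.norm_id
    rw [this, inv_one]
    exact NNReal.half_lt_self one_ne_zero
  let e := happ.toHomeomorph f hN
  have he : ∀ x, e x = f x := fun x => rfl
  have hd : ∀ x, ∃ L : E ≃L[ℝ] E, HasFDerivAt f (L : E →L[ℝ] E) x := by
    intro x
    have hfx : HasFDerivAt f (fderiv ℝ f x) x := (hf.differentiable (by norm_num) x).hasFDerivAt
    have h1 : HasFDerivAt (fun x => f x - x) (fderiv ℝ f x - ContinuousLinearMap.id ℝ E) x :=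
      hfx.sub (hasFDerivAt_id x)
    have hn : ‖fderiv ℝ f x - ContinuousLinearMap.id ℝ E‖ ≤ 1 / 2 := by
      have hl : LipschitzWith (1 / 2 : NNReal) fun x => f x - x :=
        LipschitzWith.of_dist_le_mul fun x y => by
          have := hlip x y
          rw [dist_eq_norm, dist_eq_norm]
          simpa [sub_sub_sub_comm] using this
      simpa using h1.le_of_lipschitz hl
    have hlt : ‖ContinuousLinearMap.id ℝ E - fderiv ℝ f x‖ < 1 := by
      rw [norm_sub_rev]; linarith
    refine ⟨ContinuousLinearEquiv.unitsEquiv ℝ E (Units.oneSub _ hlt), ?_⟩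
    convert hfx using 1
    ext v
    simp
  choose L hL using hd
  refine ⟨e.symm, e.contDiff_symm (f₀' := L) (fun x => hL x) hf, fun x => ?_, fun x => ?_⟩
  · rw [← he]; exact e.symm_apply_apply x
  · rw [← he]; exact e.apply_symm_apply x

/-- A shear that is the identity to second order at `δ = x = 0` coincides near `δ = x = 0` with a
global diffeomorphism, whose inverse is a shear. -/
theorem exists_inverse_shear {n : ℕ} (hn : 0 < n) {α β : Pt → ℝ} (hα : HasOrder n 2 α)
    (hβ : HasOrder n 2 β) (r : ℝ) (hr : 0 < r) :
    ∃ c, 0 < c ∧ c ≤ r ∧ ∃ χ : ℝ → ℝ, ContDiff ℝ ∞ χ ∧ (∀ x, |x| ≤ c → χ x = 1) ∧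
      (∀ x, |x * χ x| ≤ 2 * c) ∧ ∃ α' β', HasOrder n 1 α' ∧ IsSymbol n β' ∧
        (∀ p, shear (fun p => α (truncate χ p)) (fun p => β (truncate χ p)) (shear α' β' p) = p) ∧
        ∀ p, shear α' β' (shear (fun p => α (truncate χ p)) (fun p => β (truncate χ p)) p)
          = p := by
  obtain ⟨K, hK, hcut⟩ := exists_cutoff
  obtain ⟨C₁, hC₁, h₁⟩ := hα.exists_lipschitz hn
  obtain ⟨C₂, hC₂, h₂⟩ := hβ.exists_lipschitz hn
  -- The last bound makes the Lipschitz constant `(C₁ + C₂) · 2c · (K + 1)` of the cut-off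
  -- corrections at most `1/2`; it is essential that `K` does not depend on `c`.
  set c := min (min r (1 / 2)) (1 / (4 * (C₁ + C₂ + 1) * (K + 1))) with hc
  have hc0 : 0 < c := by positivity
  have hc1 : 2 * c ≤ 1 := by
    have : c ≤ 1 / 2 := (min_le_left _ _).trans (min_le_right _ _)
    linarith
  have hcC : (C₁ + C₂) * (2 * c) * (K + 1) ≤ 1 / 2 := by
    have : c ≤ 1 / (4 * (C₁ + C₂ + 1) * (K + 1)) := min_le_right _ _
    rw [le_div_iff₀ (by positivity)] at this
    nlinarith [mul_pos hc0 (by linarith : 0 < K + 1)]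
  obtain ⟨χ, hχ, hχ1, hχ2, hχ3⟩ := hcut c hc0
  refine ⟨c, hc0, (min_le_left _ _).trans (min_le_left _ _), χ, hχ, hχ1, hχ2, ?_⟩
  set α₀ : Pt → ℝ := fun p => α (truncate χ p) with hα₀
  set β₀ : Pt → ℝ := fun p => β (truncate χ p) with hβ₀
  have oα : HasOrder n 2 α₀ := hα.comp_truncate hχ
  have oβ : HasOrder n 2 β₀ := hβ.comp_truncate hχ
  have hT : ∀ p p', ‖truncate χ p - truncate χ p'‖ ≤ (K + 1) * ‖p - p'‖ := by
    intro p p'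
    have hm : ∀ a : ℝ, a ≤ ‖p - p'‖ → a ≤ (K + 1) * ‖p - p'‖ := fun a ha => by
      nlinarith [norm_nonneg (p - p')]
    have n1 : |p.1 - p'.1| ≤ ‖p - p'‖ := norm_fst_le (p - p')
    have n2 : |p.2.1 - p'.2.1| ≤ ‖p - p'‖ :=
      (norm_fst_le (p - p').2).trans (norm_snd_le (p - p'))
    refine norm_prod_le_iff.2 ⟨?_, norm_prod_le_iff.2 ⟨?_, ?_⟩⟩
    · exact (hχ3 p.1 p'.1).trans (by nlinarith [abs_nonneg (p.1 - p'.1)])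
    · exact (hχ3 p.2.1 p'.2.1).trans (by nlinarith [abs_nonneg (p.2.1 - p'.2.1)])
    · exact hm _ ((norm_snd_le (p - p').2).trans (norm_snd_le (p - p')))
  have hl : ∀ (γ : Pt → ℝ) (C : ℝ), 0 ≤ C → C ≤ C₁ + C₂ → (∀ c, c ≤ 1 → ∀ p p' : Pt,
      |p.1| ≤ c → |p.2.1| ≤ c → |p'.1| ≤ c → |p'.2.1| ≤ c → |γ p - γ p'| ≤ C * c * ‖p - p'‖) →
      ∀ p p', |γ (truncate χ p) - γ (truncate χ p')| ≤ 1 / 2 * ‖p - p'‖ := by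
    intro γ C hC hCC hγ p p'
    refine (hγ (2 * c) hc1 _ _ (hχ2 _) (hχ2 _) (hχ2 _) (hχ2 _)).trans ?_
    calc C * (2 * c) * ‖truncate χ p - truncate χ p'‖
        ≤ (C₁ + C₂) * (2 * c) * ((K + 1) * ‖p - p'‖) := by gcongr; exact hT p p'
      _ = (C₁ + C₂) * (2 * c) * (K + 1) * ‖p - p'‖ := by ring
      _ ≤ 1 / 2 * ‖p - p'‖ := by gcongr
  have heq := isEquivariant_shear oα.isSymbol oβ.isSymbol
  obtain ⟨Θ, hΘ, hΘ1, hΘ2⟩ := exists_homeomorph_of_lipschitz_sub_id heq.smooth (by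
    intro p p'
    have e : shear α₀ β₀ p - shear α₀ β₀ p' - (p - p')
        = (0, α₀ p - α₀ p', β₀ p - β₀ p', 0) := by
      ext <;> simp [shear] <;> ring
    rw [e]
    refine norm_prod_le_iff.2 ⟨by simp, norm_prod_le_iff.2 ⟨?_,
      norm_prod_le_iff.2 ⟨?_, by simp⟩⟩⟩
    · exact hl α C₁ hC₁ (by linarith) h₁ p p'
    · exact hl β C₂ hC₂ (by linarith) h₂ p p')
  -- The inverse inherits the equivariance, keeps `δ` and `S`, and fixes `{δ = x = 0}` pointwise. So
  -- it is a shear, and its `x`-correction has order one.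
  have hΘw : ∀ w, IsPeriod n w → ∀ p, Θ (p + w) = Θ p + w := fun w hw p => by
    conv_lhs => rw [← hΘ2 p]
    rw [← heq.equivariant w hw, hΘ1]
  have hcomp : ∀ p, (Θ p).1 = p.1 ∧ (Θ p).2.2.2 = p.2.2.2 := fun p =>
    ⟨(congrArg Prod.fst (hΘ2 p) : (shear α₀ β₀ (Θ p)).1 = p.1),
      (congrArg (fun z : Pt => z.2.2.2) (hΘ2 p) : (shear α₀ β₀ (Θ p)).2.2.2 = p.2.2.2)⟩
  have hΘeq : ∀ p, shear (fun p => (Θ p).2.1 - p.2.1) (fun p => (Θ p).2.2.1 - p.2.2.1) p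
      = Θ p := fun p => by
    ext <;> simp [shear, hcomp]
  have hΘ0 : ∀ Ψ S, Θ (0, 0, Ψ, S) = (0, 0, Ψ, S) := fun Ψ S => by
    have : shear α₀ β₀ (0, 0, Ψ, S) = (0, 0, Ψ, S) := by
      simp [shear, oα.eq_zero, oβ.eq_zero]
    conv_lhs => rw [← this]
    rw [hΘ1]
  refine ⟨fun p => (Θ p).2.1 - p.2.1, fun p => (Θ p).2.2.1 - p.2.2.1,
    IsSymbol.hasOrder_one ⟨by fun_prop, fun w hw p => by simp [hΘw w hw]⟩
      (fun Ψ S => by simp [hΘ0]), ⟨by fun_prop, fun w hw p => by simp [hΘw w hw]⟩, fun p => ?_,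
    fun p => ?_⟩
  · rw [hΘeq, hΘ2]
  · rw [hΘeq, hΘ1]

/-! ### The time scale, the phase and the domains. -/

/-- The small parameter `δ = t^{-1/(2q)}`. -/
noncomputable def timeScale (q : ℕ) (t : ℝ) : ℝ := t ^ (-(1 / (2 * (q : ℝ))))

section TimeScale

variable {q : ℕ}

theorem timeScale_pos {t : ℝ} (ht : 0 < t) : 0 < timeScale q t := Real.rpow_pos_of_pos ht _

theorem rpow_eq_timeScale_pow {t : ℝ} (ht : 0 < t) (k : ℕ) :
    t ^ (-((k : ℝ) / (2 * (q : ℝ)))) = timeScale q t ^ k := by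
  rw [timeScale, ← Real.rpow_natCast, ← Real.rpow_mul ht.le]
  congr 1
  ring

theorem rpow_eq_timeScale_pow_two_mul (hq : 1 ≤ q) {t : ℝ} (ht : 0 < t) (k : ℕ) :
    t ^ (-((k : ℝ) / (q : ℝ))) = timeScale q t ^ (2 * k) := by
  have : (q : ℝ) ≠ 0 := by positivity
  rw [← rpow_eq_timeScale_pow ht]
  congr 1
  push_cast
  field_simp

theorem timeScale_pow_two_mul (hq : 1 ≤ q) {t : ℝ} (ht : 0 < t) :
    timeScale q t ^ (2 * q) = t⁻¹ := by
  have : (q : ℝ) ≠ 0 := by positivity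
  rw [← rpow_eq_timeScale_pow_two_mul hq ht, div_self this, Real.rpow_neg_one]

theorem hasDerivAt_timeScale (hq : 1 ≤ q) {t : ℝ} (ht : 0 < t) :
    HasDerivAt (timeScale q) (-(1 / (2 * (q : ℝ))) * timeScale q t ^ (2 * q + 1)) t := by
  have h := Real.hasDerivAt_rpow_const (x := t) (p := -(1 / (2 * (q : ℝ)))) (Or.inl ht.ne')
  have e : -(1 / (2 * (q : ℝ))) * timeScale q t ^ (2 * q + 1)
      = -(1 / (2 * (q : ℝ))) * t ^ (-(1 / (2 * (q : ℝ))) - 1) := by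
    rw [pow_succ, timeScale_pow_two_mul hq ht, Real.rpow_sub_one ht.ne', timeScale]
    ring
  rw [e]
  exact h

theorem contDiffOn_timeScale : ContDiffOn ℝ ∞ (timeScale q) (Set.Ioi 0) := fun _ ht =>
  (Real.contDiffAt_rpow_const_of_ne (ne_of_gt ht)).contDiffWithinAt

theorem contDiffOn_phase (s : ℕ → ℝ) : ContDiffOn ℝ ∞ (phase q s) (Set.Ioi 0) := by
  intro t ht
  have ht' : t ≠ 0 := ne_of_gt ht
  unfold phase
  refine ContDiffAt.contDiffWithinAt ?_
  refine ((contDiffAt_const.mul contDiffAt_id).add (ContDiffAt.sum fun j _ => ?_)).add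
    (contDiffAt_const.mul (Real.contDiffAt_log.2 ht'))
  exact contDiffAt_const.mul (Real.contDiffAt_rpow_const_of_ne ht')

/-- The difference `S'(t) - s₀` as a polynomial in `δ`. -/
noncomputable def phaseDrift (q : ℕ) (s : ℕ → ℝ) (p : Pt) : ℝ :=
  ∑ j ∈ Finset.Ico 1 q, s j * (1 - (j : ℝ) / (q : ℝ)) * p.1 ^ (2 * j) + s q * p.1 ^ (2 * q)

theorem hasOrder_phaseDrift (n : ℕ) (hq : 1 ≤ q) (s : ℕ → ℝ) :
    HasOrder n 2 (phaseDrift q s) := by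
  have h : ∀ (c : ℝ) (j : ℕ), 1 ≤ j → HasOrder n 2 fun p => c * p.1 ^ (2 * j) := fun c j hj => by
    have := (HasOrder.fst_pow_mul (k := 0) (n := n) (IsSymbol.const c) (2 * j)).mono
      (by omega : 2 ≤ 0 + 2 * j)
    exact this.congr fun p => by ring
  refine (HasOrder.sum _ fun j hj => h _ j ?_).add (h _ q hq)
  exact (Finset.mem_Ico.1 hj).1

theorem hasDerivAt_phase (hq : 1 ≤ q) (s : ℕ → ℝ) {t : ℝ} (ht : 0 < t) {p : Pt}
    (hp : p.1 = timeScale q t) : HasDerivAt (phase q s) (s 0 + phaseDrift q s p) t := by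
  have hsum : HasDerivAt (fun t : ℝ => ∑ j ∈ Finset.Ico 1 q, s j * t ^ (1 - (j : ℝ) / (q : ℝ)))
      (∑ j ∈ Finset.Ico 1 q, s j * ((1 - (j : ℝ) / (q : ℝ)) *
        t ^ (1 - (j : ℝ) / (q : ℝ) - 1))) t :=
    HasDerivAt.fun_sum fun j _ => (Real.hasDerivAt_rpow_const (Or.inl ht.ne')).const_mul _
  have h := (((hasDerivAt_id t).const_mul (s 0)).add hsum).add
    ((Real.hasDerivAt_log ht.ne').const_mul (s q))
  have e : s 0 + phaseDrift q s p = s 0 * 1 + ∑ j ∈ Finset.Ico 1 q, s j *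
      ((1 - (j : ℝ) / (q : ℝ)) * t ^ (1 - (j : ℝ) / (q : ℝ) - 1)) + s q * t⁻¹ := by
    simp only [phaseDrift, hp, timeScale_pow_two_mul hq ht, mul_one, add_assoc]
    congr 2
    refine Finset.sum_congr rfl fun j _ => ?_
    rw [← rpow_eq_timeScale_pow_two_mul hq ht, mul_assoc]
    congr 3
    ring
  rw [e]
  exact h

/-- On the domain `R = O(t^{(1-ς)/(2q)})`, hence `δ R = O(t^{-ς/(2q)})`, which tends to zero because
`ς > 0`. -/
theorem exists_time {L a ς : ℝ} (hq : 1 ≤ q) (haL : |a| < L) (hς : 0 < ς) {r : ℝ} (hr : 0 < r) :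
    ∃ T : ℝ, 1 ≤ T ∧ ∀ t, T ≤ t → timeScale q t ≤ r ∧ ∀ τ ε R Ψ : ℝ, 0 ≤ ε →
      (R, Ψ, t) ∈ resonanceDomain L a q ε ς τ → |timeScale q t * R| ≤ r := by
  have hq' : (0 : ℝ) < q := by exact_mod_cast hq
  have hL : 0 < L := (abs_nonneg a).trans_lt haL
  have h1 := (tendsto_rpow_neg_atTop (y := 1 / (2 * (q : ℝ))) (by positivity)).eventually_le_const
    hr
  have h2 := (tendsto_rpow_neg_atTop (y := ς / (2 * (q : ℝ))) (by positivity)).eventually_le_const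
    (by positivity : 0 < r / (2 * L))
  obtain ⟨T, hT⟩ := Filter.eventually_atTop.1 (h1.and h2)
  refine ⟨max T 1, le_max_right _ _, fun t ht => ?_⟩
  have ht0 : 0 < t := by linarith [le_max_right T 1]
  obtain ⟨e1, e2⟩ := hT t ((le_max_left _ _).trans ht)
  refine ⟨e1, fun τ ε R Ψ hε hD => ?_⟩
  have hD1 := hD.1
  change |R * t ^ (-((1 - ς) / (2 * (q : ℝ)))) + a| <
    L - ε * t ^ (-((1 - ς) / (2 * (q : ℝ)))) at hD1
  set A := t ^ (-((1 - ς) / (2 * (q : ℝ)))) with hA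
  have hA0 : 0 < A := Real.rpow_pos_of_pos ht0 _
  have hRA : |R * A| ≤ 2 * L := by
    have h3 : |R * A| ≤ |R * A + a| + |a| := by
      have := abs_sub (R * A + a) a
      simpa using this
    have : 0 ≤ ε * A := by positivity
    linarith
  have hδ : timeScale q t * R = (R * A) * t ^ (-(ς / (2 * (q : ℝ)))) := by
    rw [timeScale, mul_assoc, hA, ← Real.rpow_add ht0, mul_comm]
    congr 2
    field_simp
    ring
  have hp := Real.rpow_pos_of_pos ht0 (-(ς / (2 * (q : ℝ))))
  rw [hδ, abs_mul, abs_of_pos hp]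
  calc |R * A| * t ^ (-(ς / (2 * (q : ℝ)))) ≤ (2 * L) * (r / (2 * L)) := by gcongr
    _ = r := by field_simp

end TimeScale

/-! ### From orders in `(δ, x)` to asymptotic expansions in `t`. -/

theorem IsForm.exists_bound {n : ℕ} (hn : 0 < n) : ∀ {k : ℕ} {H : Pt → ℝ}, IsForm n k H →
    ∃ C, 0 ≤ C ∧ ∀ ρ Ψ S : ℝ, |H (1, ρ, Ψ, S)| ≤ C * (1 + |ρ|) ^ k
  | 0, H, h => by
    obtain ⟨C, hC, hb⟩ := h.1.exists_bound hn 0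
    refine ⟨C, hC, fun ρ Ψ S => ?_⟩
    rw [h.2, pow_zero, mul_one]
    exact hb _ (by simp [core]) (by simp [core])
  | k + 1, H, ⟨A, B, hA, hB, e⟩ => by
    obtain ⟨C₁, hC₁, h₁⟩ := hA.exists_bound hn
    obtain ⟨C₂, hC₂, h₂⟩ := hB.exists_bound hn
    refine ⟨C₁ + C₂, by positivity, fun ρ Ψ S => ?_⟩
    have e1 := h₁ ρ Ψ S
    have e2 := h₂ ρ Ψ S
    have e3 : |ρ| ≤ 1 + |ρ| := by linarith
    have e4 : 1 ≤ 1 + |ρ| := by linarith [abs_nonneg ρ]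
    rw [e]
    calc |1 * A (1, ρ, Ψ, S) + ρ * B (1, ρ, Ψ, S)|
        ≤ 1 * |A (1, ρ, Ψ, S)| + |ρ| * |B (1, ρ, Ψ, S)| := by
          rw [← abs_mul ρ, one_mul, one_mul]; exact abs_add_le _ _
      _ ≤ (1 + |ρ|) * (C₁ * (1 + |ρ|) ^ k) + (1 + |ρ|) * (C₂ * (1 + |ρ|) ^ k) := by gcongr
      _ = (C₁ + C₂) * (1 + |ρ|) ^ (k + 1) := by ring

/-- The function `h` need not be smooth at `δ = 0`; approximation by symbols `Z i` is enough, and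
their successive leading forms are the coefficients. At `x = δρ`, order `N + e + i` means `(δ(1 +
|ρ|))^{N+e+i}`, which is the required growth. The case `e = 0` is radial, with an additional factor
`δ`; the case `e = 1` is angular. -/
theorem hasRemainderExpansion_of_approx {D : Set (ℝ × ℝ × ℝ)} {q n N e : ℕ} (hn : 0 < n)
    (he : e ≤ 1) {h : ℝ → ℝ → ℝ → ℝ → ℝ} {Z : ℕ → Pt → ℝ} (h0 : HasOrder n (N + e) (Z 0))
    (hZ : ∀ i, HasOrder n (N + e + i + 1) fun p => Z (i + 1) p - Z i p)
    (hD : ∀ ρ ψ t : ℝ, (ρ, ψ, t) ∈ D → 0 < t ∧ timeScale q t ≤ 1 ∧ |timeScale q t * ρ| ≤ 1)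
    (happ : ∀ i, ∃ C T : ℝ, 0 ≤ C ∧ 0 < T ∧ ∀ ρ ψ S t : ℝ, (ρ, ψ, t) ∈ D → T ≤ t →
      |h ρ ψ S t - timeScale q t ^ (1 - e) * Z i (timeScale q t, timeScale q t * ρ, ψ, S)|
        ≤ C * timeScale q t ^ (N + i + 1)) :
    HasRemainderExpansion D q n N e h := by
  obtain ⟨c, hc, hZc⟩ := h0.exists_expansion hZ
  -- The coefficient of `t^{-k/(2q)}` comes from the form of degree `k - 1 + e`, whose index counted
  -- from zero is `k - (N + 1)`.
  refine ⟨fun k ρ ψ S => c (k - (N + 1)) (1, ρ, ψ, S), fun k hk => ⟨fun ρ ψ S => ⟨?_, ?_⟩, ?_⟩,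
    fun M hM => ?_⟩
  · simpa using (hc (k - (N + 1))).hasOrder.isSymbol.periodic _ (Or.inl rfl) (1, ρ, ψ, S)
  · simpa using (hc (k - (N + 1))).hasOrder.isSymbol.periodic _ (Or.inr rfl) (1, ρ, ψ, S)
  · obtain ⟨C, -, hC⟩ := (hc (k - (N + 1))).exists_bound hn
    refine ⟨C, fun ρ ψ S => ?_⟩
    have : N + e + (k - (N + 1)) = k - 1 + e := by omega
    rw [← this]
    exact hC ρ ψ S
  · obtain ⟨i, rfl⟩ := Nat.exists_eq_add_of_le hM
    obtain ⟨C, T, hC, hT, hb⟩ := happ i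
    obtain ⟨C', hC', hb'⟩ := (hZc i).exists_bound hn 1
    refine ⟨C + C', T, hT, fun ρ ψ S t hp ht => ?_⟩
    obtain ⟨ht0, hδ1, hδρ⟩ := hD ρ ψ t hp
    have hδ := timeScale_pos (q := q) ht0
    set δ := timeScale q t with hδdef
    have hρ : 1 ≤ 1 + |ρ| := by linarith [abs_nonneg ρ]
    have e1 := hb ρ ψ S t hp ht
    have e2 := hb' (δ, δ * ρ, ψ, S) (by simpa [abs_of_pos hδ] using hδ1) hδρ
    have e3 : |δ| + |δ * ρ| = δ * (1 + |ρ|) := by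
      rw [abs_mul, abs_of_pos hδ]; ring
    simp only [e3] at e2
    have hsum : ∑ k ∈ Finset.Icc (N + 1) (N + i), t ^ (-((k : ℝ) / (2 * (q : ℝ)))) *
          c (k - (N + 1)) (1, ρ, ψ, S)
        = δ ^ (1 - e) * ∑ j ∈ Finset.range i, c j (δ, δ * ρ, ψ, S) := by
      rw [← Finset.Ico_add_one_right_eq_Icc, Finset.sum_Ico_eq_sum_range, Finset.mul_sum,
        show N + i + 1 - (N + 1) = i by omega]
      refine Finset.sum_congr rfl fun j _ => ?_
      rw [rpow_eq_timeScale_pow ht0, (hc j).homogeneous, ← mul_assoc, ← pow_add,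
        show 1 - e + (N + e + j) = N + 1 + j by omega, add_tsub_cancel_left]
    have e4 : t ^ (-((((N + i : ℕ) : ℝ) + 1) / (2 * (q : ℝ)))) = δ ^ (N + i + 1) := by
      rw [← rpow_eq_timeScale_pow ht0]
      push_cast
      rfl
    rw [hsum, e4]
    calc |h ρ ψ S t - δ ^ (1 - e) * ∑ j ∈ Finset.range i, c j (δ, δ * ρ, ψ, S)|
        = |(h ρ ψ S t - δ ^ (1 - e) * Z i (δ, δ * ρ, ψ, S)) + δ ^ (1 - e) *
            (Z i (δ, δ * ρ, ψ, S) - ∑ j ∈ Finset.range i, c j (δ, δ * ρ, ψ, S))| := by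
          congr 1; ring
      _ ≤ C * δ ^ (N + i + 1) + δ ^ (1 - e) * (C' * (δ * (1 + |ρ|)) ^ (N + e + i)) := by
          refine (abs_add_le _ _).trans (add_le_add e1 ?_)
          rw [abs_mul, abs_of_pos (pow_pos hδ _)]
          gcongr
      _ = C * 1 * δ ^ (N + i + 1) + C' * (1 + |ρ|) ^ (N + i + e) *
            (δ ^ (1 - e) * δ ^ (N + e + i)) := by
          rw [mul_pow, show N + e + i = N + i + e by omega]; ring
      _ ≤ C * (1 + |ρ|) ^ (N + i + e) * δ ^ (N + i + 1) + C' * (1 + |ρ|) ^ (N + i + e) *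
            δ ^ (N + i + 1) := by
          rw [← pow_add, show 1 - e + (N + e + i) = N + i + 1 by omega]
          gcongr
          exact one_le_pow₀ hρ
      _ = (C + C') * (1 + |ρ|) ^ (N + i + e) * δ ^ (N + i + 1) := by ring

theorem HasRemainderExpansion.isRemainder {D : Set (ℝ × ℝ × ℝ)} {q n N e : ℕ}
    {h : ℝ → ℝ → ℝ → ℝ → ℝ} (hh : HasRemainderExpansion D q n N e h) : IsRemainder D q N h := by
  obtain ⟨c, -, hc⟩ := hh
  obtain ⟨C, T, hT, hb⟩ := hc N le_rfl
  intro B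
  refine ⟨|C| * (1 + |B|) ^ (N + e), T, hT, fun ρ ψ S t hp hB ht => ?_⟩
  have h1 := hb ρ ψ S t hp ht
  rw [Finset.Icc_eq_empty (by omega), Finset.sum_empty, sub_zero] at h1
  have h2 : 0 ≤ t ^ (-(((N : ℝ) + 1) / (2 * (q : ℝ)))) :=
    Real.rpow_nonneg (hT.le.trans ht) _
  refine h1.trans ?_
  have h3 : |ρ| ≤ |B| := hB.trans (le_abs_self B)
  gcongr
  exact le_abs_self C

/-- In `K = δ A + x B` the factors `A` and `B` restrict on `{δ = x = 0}` to the first derivatives of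
`K`, so Hadamard's lemma applies once more to each. -/
theorem IsSymbol.hasOrder_two {n : ℕ} {K : Pt → ℝ} (hK : IsSymbol n K)
    (h0 : ∀ Ψ S, K (0, 0, Ψ, S) = 0) (h1 : ∀ Ψ S, dirDeriv (1, 0, 0, 0) K (0, 0, Ψ, S) = 0)
    (h2 : ∀ Ψ S, dirDeriv (0, 1, 0, 0) K (0, 0, Ψ, S) = 0) : HasOrder n 2 K := by
  obtain ⟨A, B, hA, hB, e⟩ := hK.hasOrder_one h0
  have hc := fun (v : Pt) (p : Pt) =>
    dirDeriv_coords v (hA.isSymbol.differentiableAt p) (hB.isSymbol.differentiableAt p)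
  rw [← e] at hc
  refine ⟨A, B, hA.isSymbol.hasOrder_one fun Ψ S => ?_, hB.isSymbol.hasOrder_one fun Ψ S => ?_, e⟩
  · simpa [h1] using (hc (1, 0, 0, 0) (0, 0, Ψ, S)).symm
  · simpa [h2] using (hc (0, 1, 0, 0) (0, 0, Ψ, S)).symm

/-! ### The change of variables and the flow in the original time. -/

/-- The point `(δ, δ R, Ψ, S(t))`. -/
noncomputable def embed (q : ℕ) (s : ℕ → ℝ) (R Ψ t : ℝ) : Pt :=
  (timeScale q t, timeScale q t * R, Ψ, phase q s t)

theorem contDiffOn_embed (q : ℕ) (s : ℕ → ℝ) :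
    ContDiffOn ℝ ∞ (fun p : ℝ × ℝ × ℝ => embed q s p.1 p.2.1 p.2.2)
      (Set.univ ×ˢ Set.univ ×ˢ Set.Ioi 0) := by
  have hm : Set.MapsTo (fun p : ℝ × ℝ × ℝ => p.2.2)
      (Set.univ ×ˢ Set.univ ×ˢ Set.Ioi 0 : Set (ℝ × ℝ × ℝ)) (Set.Ioi 0) := fun p hp => hp.2.2
  have hs : ContDiffOn ℝ ∞ (fun p : ℝ × ℝ × ℝ => p.2.2)
      (Set.univ ×ˢ Set.univ ×ˢ Set.Ioi 0) := by fun_prop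
  have h1 := (contDiffOn_timeScale (q := q)).comp hs hm
  have h2 := (contDiffOn_phase (q := q) s).comp hs hm
  exact h1.prodMk ((h1.mul contDiffOn_fst).prodMk
    (ContDiffOn.prodMk (by fun_prop) h2))

theorem shear_embed {q : ℕ} (α β : Pt → ℝ) (s : ℕ → ℝ) (R Ψ : ℝ) {t : ℝ} (ht : 0 < t) :
    shear α β (embed q s R Ψ t)
      = embed q s (R + (timeScale q t)⁻¹ * α (embed q s R Ψ t)) (Ψ + β (embed q s R Ψ t)) t := by
  have := (timeScale_pos (q := q) ht).ne'
  ext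
  · rfl
  · simp only [shear, embed]; field_simp
  · rfl
  · rfl

/-- Injectivity and the inverse are those of the global shear, restricted to time slices. As `|X| ≤
ε`, passing to the inverse image moves `R t^{-(1-ς)/(2q)}` by at most `ε t^{-(1-ς)/(2q)}`, exactly
the margin between the two domains. -/
theorem isNearIdentityChange_of_shear {n q : ℕ} {s : ℕ → ℝ} {L a ς ε r t₀ : ℝ}
    {α β α' β' : Pt → ℝ} (hα : IsSymbol n α) (hβ : IsSymbol n β) (hα' : IsSymbol n α')
    (hβ' : IsSymbol n β') (h12 : ∀ p, shear α β (shear α' β' p) = p)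
    (h21 : ∀ p, shear α' β' (shear α β p) = p)
    (hX : ∀ p : Pt, 0 < p.1 → p.1 ≤ r → |α p| ≤ ε * p.1)
    (hY : ∀ p : Pt, |p.1| ≤ r → |p.2.1| ≤ r → |β p| ≤ ε) (ht₀ : 1 ≤ t₀)
    (hT : ∀ t, t₀ ≤ t → timeScale q t ≤ r ∧ ∀ τ ε R Ψ : ℝ, 0 ≤ ε →
      (R, Ψ, t) ∈ resonanceDomain L a q ε ς τ → |timeScale q t * R| ≤ r) :
    IsNearIdentityChange ε (resonanceDomain L a q 0 ς t₀) (resonanceDomain L a q ε ς t₀)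
      (fun R Ψ t => (timeScale q t)⁻¹ * α (embed q s R Ψ t))
      (fun R Ψ t => β (embed q s R Ψ t)) := by
  have hδ : ∀ t, 0 < t → 0 < timeScale q t := fun t ht => timeScale_pos ht
  have hpos : ∀ {ε R Ψ t : ℝ}, (R, Ψ, t) ∈ resonanceDomain L a q ε ς t₀ → t₀ ≤ t ∧ 0 < t :=
    fun h => ⟨h.2, by have := h.2; simp only at this; linarith⟩
  have hinv : ContDiffOn ℝ ∞ (fun p : ℝ × ℝ × ℝ => (timeScale q p.2.2)⁻¹)
      (Set.univ ×ˢ Set.univ ×ˢ Set.Ioi 0) :=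
    ((contDiffOn_timeScale (q := q)).comp (by fun_prop) fun p hp => hp.2.2).inv
      fun p hp => (hδ _ hp.2.2).ne'
  -- No bound on `R` is assumed: the estimate is applied at the inverse image before that point is
  -- known to lie in the domain.
  have hXb : ∀ R Ψ t : ℝ, t₀ ≤ t → 0 < t → |(timeScale q t)⁻¹ * α (embed q s R Ψ t)| ≤ ε := by
    intro R Ψ t h1 h2
    have := hX (embed q s R Ψ t) (hδ t h2) (hT t h1).1
    rw [abs_mul, abs_of_pos (inv_pos.2 (hδ t h2)), inv_mul_le_iff₀ (hδ t h2), mul_comm]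
    exact this
  have hshear : ∀ R Ψ t : ℝ, 0 < t → shear α β (embed q s R Ψ t)
      = embed q s (R + (timeScale q t)⁻¹ * α (embed q s R Ψ t)) (Ψ + β (embed q s R Ψ t)) t :=
    fun R Ψ t ht => shear_embed α β s R Ψ ht
  refine ⟨hinv.mul (hα.smooth.comp_contDiffOn (contDiffOn_embed q s)),
    hβ.smooth.comp_contDiffOn (contDiffOn_embed q s), fun R Ψ t _ => ?_, fun R Ψ t h => ?_, ?_, ?_⟩
  · have e : embed q s R (Ψ + 2 * Real.pi) t = embed q s R Ψ t + (0, 0, 2 * Real.pi, 0) := by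
      simp [embed]
    simp only [e, hα.periodic _ (Or.inl rfl), hβ.periodic _ (Or.inl rfl), and_self]
  · obtain ⟨h1, h2⟩ := hpos h
    refine ⟨hXb R Ψ t h1 h2, hY _ ?_ ((hT t h1).2 _ _ R Ψ le_rfl h)⟩
    rw [embed, abs_of_pos (hδ t h2)]
    exact (hT t h1).1
  · intro R Ψ R' Ψ' t h _ e1 e2
    obtain ⟨-, h2⟩ := hpos h
    have e : embed q s R Ψ t = embed q s R' Ψ' t := by
      rw [← h21 (embed q s R Ψ t), hshear R Ψ t h2, e1, e2, ← hshear R' Ψ' t h2, h21]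
    simp only [embed, Prod.mk.injEq] at e
    exact ⟨mul_left_cancel₀ (hδ t h2).ne' e.2.1, e.2.2.1⟩
  · have hsub : resonanceDomain L a q ε ς t₀ ⊆ Set.univ ×ˢ Set.univ ×ˢ Set.Ioi 0 :=
      fun p hp => ⟨trivial, trivial, (hpos (R := p.1) (Ψ := p.2.1) (t := p.2.2) hp).2⟩
    refine ⟨fun ρ ψ t => (timeScale q t)⁻¹ * (shear α' β' (embed q s ρ ψ t)).2.1,
      fun ρ ψ t => (shear α' β' (embed q s ρ ψ t)).2.2.1, ?_, ?_, fun ρ ψ t h => ?_⟩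
    · have := (isEquivariant_shear hα' hβ').smooth.snd.fst.comp_contDiffOn (contDiffOn_embed q s)
      exact (hinv.mul this).mono hsub
    · have := (isEquivariant_shear hα' hβ').smooth.snd.snd.fst.comp_contDiffOn
        (contDiffOn_embed q s)
      exact this.mono hsub
    · obtain ⟨h1, h2⟩ := hpos h
      have hδt := hδ t h2
      set u := (timeScale q t)⁻¹ * (shear α' β' (embed q s ρ ψ t)).2.1 with hu
      set v := (shear α' β' (embed q s ρ ψ t)).2.2.1 with hv
      have e : shear α' β' (embed q s ρ ψ t) = embed q s u v t := by
        ext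
        · rfl
        · simp only [hu, embed]; field_simp
        · rfl
        · rfl
      have e' := hshear u v t h2
      rw [← e, h12, e] at e'
      simp only [embed, Prod.mk.injEq] at e'
      have eu : u + (timeScale q t)⁻¹ * α (embed q s u v t) = ρ :=
        (mul_left_cancel₀ hδt.ne' e'.2.1).symm
      refine ⟨⟨?_, h1⟩, eu, e'.2.2.1.symm⟩
      have hD := h.1
      have hb := hXb u v t h1 h2
      change |u * t ^ (-((1 - ς) / (2 * (q : ℝ)))) + a|
        < L - 0 * t ^ (-((1 - ς) / (2 * (q : ℝ))))
      change |ρ * t ^ (-((1 - ς) / (2 * (q : ℝ)))) + a|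
        < L - ε * t ^ (-((1 - ς) / (2 * (q : ℝ)))) at hD
      have hA : 0 < t ^ (-((1 - ς) / (2 * (q : ℝ)))) := Real.rpow_pos_of_pos h2 _
      set A := t ^ (-((1 - ς) / (2 * (q : ℝ))))
      have e1 : u * A + a = (ρ * A + a)
          - (timeScale q t)⁻¹ * α (embed q s u v t) * A := by rw [← eu]; ring
      have e2 : |(timeScale q t)⁻¹ * α (embed q s u v t) * A| ≤ ε * A := by
        rw [abs_mul, abs_of_pos hA]; gcongr
      rw [e1]
      have := abs_sub (ρ * A + a) ((timeScale q t)⁻¹ * α (embed q s u v t) * A)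
      linarith

section Flow

variable {q : ℕ} {s₀ : ℝ} {σ F G : Pt → ℝ} {z : ℝ → Pt} {t : ℝ}

theorem hasDerivAt_comp_of_flow (hz : HasDerivAt z (-(1 / (2 * (q : ℝ))) * (z t).1 ^ (2 * q + 1),
      (z t).1 ^ 2 * F (z t), G (z t), s₀ + σ (z t)) t) {H : Pt → ℝ}
    (hH : DifferentiableAt ℝ H (z t)) :
    HasDerivAt (fun t => H (z t)) (transport q s₀ σ F G H (z t)) t := by
  have := hH.hasFDerivAt.comp_hasDerivAt t hz
  rw [fderiv_eq_sum_dirDeriv] at this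
  refine this.congr_deriv ?_
  simp only [transport]
  ring

theorem hasDerivAt_radius_of_flow (hq : 1 ≤ q)
    (hz : HasDerivAt z (-(1 / (2 * (q : ℝ))) * (z t).1 ^ (2 * q + 1),
      (z t).1 ^ 2 * F (z t), G (z t), s₀ + σ (z t)) t) {P : Pt → ℝ}
    (hP : DifferentiableAt ℝ P (z t)) (h0 : (z t).1 ≠ 0) :
    HasDerivAt (fun t => (z t).1⁻¹ * (z t).2.1 + (z t).1 * P (z t))
      ((z t).1 * radialRate q s₀ σ F G P (z t)) t := by
  have h1 : HasDerivAt (fun t => (z t).1) (-(1 / (2 * (q : ℝ))) * (z t).1 ^ (2 * q + 1)) t :=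
    (hasFDerivAt_fst (𝕜 := ℝ) (p := z t)).comp_hasDerivAt t hz
  have h2 : HasDerivAt (fun t => (z t).2.1) ((z t).1 ^ 2 * F (z t)) t :=
    ((hasFDerivAt_fst (𝕜 := ℝ) (p := (z t).2)).comp (z t)
      (hasFDerivAt_snd (𝕜 := ℝ) (p := z t))).comp_hasDerivAt t hz
  have h := ((h1.inv h0).mul h2).add (h1.mul (hasDerivAt_comp_of_flow hz hP))
  refine h.congr_deriv ?_
  -- Writing `q = m + 1` removes the truncated subtraction in the exponent `2 * (q - 1)`.
  obtain ⟨m, rfl⟩ := Nat.exists_eq_add_of_le' hq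
  simp only [radialRate, Nat.add_sub_cancel, Pi.inv_apply]
  field_simp
  ring

end Flow

/-! ### The original right-hand sides near the resonance. -/

/-- The coefficient `c` near the resonance, in the variables `(δ, x, Ψ, S)`, with `x` cut off. -/
def pullback (a m : ℝ) (χ : ℝ → ℝ) (c : ℝ → ℝ → ℝ → ℝ) (p : Pt) : ℝ :=
  c (a + p.2.1 * χ p.2.1) (m * p.2.2.2 + p.2.2.1) p.2.2.2

/-- Shifting `S` by `2πκ'` shifts `(κ/κ')S` by `2πκ`, again a multiple of `2π`; this is the origin
of the period `2πκ'`. -/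
theorem resonant_shift_eq {κ κ' : ℕ} (hκ' : 0 < κ') {c : ℝ → ℝ → ℝ}
    (h1 : ∀ φ S, c (φ + 2 * Real.pi) S = c φ S) (h2 : ∀ φ S, c φ (S + 2 * Real.pi) = c φ S)
    (Ψ S : ℝ) :
    c ((κ : ℝ) / (κ' : ℝ) * S + (Ψ + 2 * Real.pi)) S = c ((κ : ℝ) / (κ' : ℝ) * S + Ψ) S ∧
    c ((κ : ℝ) / (κ' : ℝ) * (S + 2 * Real.pi * (κ' : ℝ)) + Ψ) (S + 2 * Real.pi * (κ' : ℝ))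
      = c ((κ : ℝ) / (κ' : ℝ) * S + Ψ) S := by
  have hκ : (κ' : ℝ) ≠ 0 := by positivity
  constructor
  · rw [← add_assoc, h1]
  · have e1 : ∀ S, Function.Periodic (fun φ => c φ S) (κ * (2 * Real.pi)) := fun S =>
      Function.Periodic.nat_mul (fun φ => h1 φ S) κ
    have e2 : ∀ φ, Function.Periodic (c φ) (κ' * (2 * Real.pi)) := fun φ =>
      Function.Periodic.nat_mul (fun S => h2 φ S) κ'
    rw [show 2 * Real.pi * (κ' : ℝ) = κ' * (2 * Real.pi) by ring, e2,
      show (κ : ℝ) / (κ' : ℝ) * (S + κ' * (2 * Real.pi)) + Ψ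
        = (κ : ℝ) / (κ' : ℝ) * S + Ψ + κ * (2 * Real.pi) by field_simp; ring]
    exact e1 S _

theorem isSymbol_pullback {κ κ' : ℕ} (hκ' : 0 < κ') {L a : ℝ} {χ : ℝ → ℝ} (hχ : ContDiff ℝ ∞ χ)
    (hχL : ∀ x, |a + x * χ x| ≤ L) {c : ℝ → ℝ → ℝ → ℝ} (hc : IsCoefficient L c) :
    IsSymbol κ' (pullback a ((κ : ℝ) / (κ' : ℝ)) χ c) := by
  refine ⟨?_, ?_⟩
  · refine hc.1.comp_contDiff (f := fun p : Pt =>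
      (a + p.2.1 * χ p.2.1, (κ : ℝ) / (κ' : ℝ) * p.2.2.2 + p.2.2.1, p.2.2.2)) (by fun_prop)
      fun p => ⟨abs_le.1 (hχL _), trivial, trivial⟩
  · intro w hw p
    have h := fun Ψ S => resonant_shift_eq (κ := κ) hκ' (c := c (a + p.2.1 * χ p.2.1))
      (fun φ S => (hc.2 _ φ S (hχL _)).1) (fun φ S => (hc.2 _ φ S (hχL _)).2) Ψ S
    rcases hw with rfl | rfl
    · simpa [pullback] using (h p.2.2.1 p.2.2.2).1
    · simpa [pullback] using (h p.2.2.1 p.2.2.2).2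

theorem HasPowerExpansion.exists_bound {L : ℝ} {q : ℕ} (hq : 1 ≤ q) {h : ℝ → ℝ → ℝ → ℝ → ℝ}
    {c : ℕ → ℝ → ℝ → ℝ → ℝ} (hh : HasPowerExpansion L q h c) (M : ℕ) :
    ∃ C T : ℝ, 0 ≤ C ∧ 0 < T ∧ ∀ r φ S t : ℝ, |r| ≤ L → T ≤ t →
      |h r φ S t - ∑ j ∈ Finset.range M, timeScale q t ^ (2 * (j + 1)) * c (j + 1) r φ S|
        ≤ C * timeScale q t ^ (2 * (M + 1)) := by
  obtain ⟨C, T, hT, hb⟩ := hh (M + 1) (by omega)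
  refine ⟨|C|, T, abs_nonneg _, hT, fun r φ S t hr ht => ?_⟩
  have ht0 : 0 < t := hT.trans_le ht
  have h1 := hb r φ S t hr ht
  rw [rpow_eq_timeScale_pow_two_mul hq ht0, Finset.sum_Ico_eq_sum_range] at h1
  simp only [rpow_eq_timeScale_pow_two_mul hq ht0, Nat.add_sub_cancel] at h1
  simp only [add_comm 1] at h1
  refine h1.trans ?_
  have := pow_pos (timeScale_pos (q := q) ht0) (2 * (M + 1))
  gcongr
  exact le_abs_self C

/-- The truncated expansion of `δ⁻² f`. -/
def fieldF (a m : ℝ) (χ : ℝ → ℝ) (fj : ℕ → ℝ → ℝ → ℝ → ℝ) (M : ℕ) (p : Pt) : ℝ :=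
  ∑ j ∈ Finset.range M, p.1 ^ (2 * j) * pullback a m χ (fj (j + 1)) p

/-- The truncated expansion of `Ψ'`. -/
def fieldG (a m : ℝ) (χ : ℝ → ℝ) (freq : ℝ → ℝ) (σ : Pt → ℝ) (gj : ℕ → ℝ → ℝ → ℝ → ℝ) (M : ℕ)
    (p : Pt) : ℝ :=
  freq (a + p.2.1 * χ p.2.1) - freq a
    + ∑ j ∈ Finset.range M, p.1 ^ (2 * (j + 1)) * pullback a m χ (gj (j + 1)) p - m * σ p

/-- The function `δ⁻² f` at the time `t`. -/
noncomputable def exactF (q : ℕ) (a m : ℝ) (f : ℝ → ℝ → ℝ → ℝ → ℝ) (t : ℝ) (p : Pt) : ℝ :=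
  (timeScale q t ^ 2)⁻¹ * f (a + p.2.1) (m * p.2.2.2 + p.2.2.1) p.2.2.2 t

/-- The derivative of `Ψ` at the time `t`. -/
def exactG (a m : ℝ) (freq : ℝ → ℝ) (σ : Pt → ℝ) (g : ℝ → ℝ → ℝ → ℝ → ℝ) (t : ℝ) (p : Pt) : ℝ :=
  freq (a + p.2.1) - freq a + g (a + p.2.1) (m * p.2.2.2 + p.2.2.1) p.2.2.2 t - m * σ p

/-- Where `|x| ≤ c` the cut-off is inactive, and only the remainders of the two expansions are left.
Division by `δ²` turns `δ^{2M+2}` into `δ^{2M}` for the radial field. -/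
theorem exists_field_bound {L a m c : ℝ} {q : ℕ} (hq : 1 ≤ q) {χ : ℝ → ℝ} {freq : ℝ → ℝ}
    {σ : Pt → ℝ} {f g : ℝ → ℝ → ℝ → ℝ → ℝ} {fj gj : ℕ → ℝ → ℝ → ℝ → ℝ}
    (hf : HasPowerExpansion L q f fj) (hg : HasPowerExpansion L q g gj)
    (hχL : ∀ x, |a + x * χ x| ≤ L) (hχ1 : ∀ x, |x| ≤ c → χ x = 1) (M : ℕ) :
    ∃ C T : ℝ, 0 ≤ C ∧ 0 < T ∧ ∀ (t : ℝ) (p : Pt), T ≤ t → p.1 = timeScale q t → |p.2.1| ≤ c →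
      |exactF q a m f t p - fieldF a m χ fj M p| ≤ C * p.1 ^ (2 * M) ∧
      |exactG a m freq σ g t p - fieldG a m χ freq σ gj M p| ≤ C * p.1 ^ (2 * M + 2) := by
  obtain ⟨C₁, T₁, hC₁, hT₁, h₁⟩ := hf.exists_bound hq M
  obtain ⟨C₂, T₂, hC₂, hT₂, h₂⟩ := hg.exists_bound hq M
  refine ⟨C₁ + C₂, max T₁ T₂, by positivity, lt_max_of_lt_left hT₁, fun t p ht hp hx => ?_⟩
  have ht0 : 0 < t := hT₁.trans_le ((le_max_left _ _).trans ht)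
  have hδ := timeScale_pos (q := q) ht0
  have hr : |a + p.2.1| ≤ L := by simpa [hχ1 _ hx] using hχL p.2.1
  have e₁ := h₁ _ (m * p.2.2.2 + p.2.2.1) p.2.2.2 t hr ((le_max_left _ _).trans ht)
  have e₂ := h₂ _ (m * p.2.2.2 + p.2.2.1) p.2.2.2 t hr ((le_max_right _ _).trans ht)
  rw [← hp] at e₁ e₂ hδ
  constructor
  · have e : exactF q a m f t p - fieldF a m χ fj M p = (p.1 ^ 2)⁻¹ *
        (f (a + p.2.1) (m * p.2.2.2 + p.2.2.1) p.2.2.2 t - ∑ j ∈ Finset.range M,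
          p.1 ^ (2 * (j + 1)) * fj (j + 1) (a + p.2.1) (m * p.2.2.2 + p.2.2.1) p.2.2.2) := by
      simp only [exactF, fieldF, pullback, hχ1 _ hx, mul_one, ← hp, mul_sub, Finset.mul_sum]
      congr 1
      refine Finset.sum_congr rfl fun j _ => ?_
      rw [mul_add, pow_add]
      field_simp
    rw [e, abs_mul, abs_of_pos (by positivity), inv_mul_le_iff₀ (by positivity)]
    refine e₁.trans ?_
    calc C₁ * p.1 ^ (2 * (M + 1)) ≤ (C₁ + C₂) * p.1 ^ (2 * (M + 1)) := by gcongr; linarith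
      _ = p.1 ^ 2 * ((C₁ + C₂) * p.1 ^ (2 * M)) := by ring
  · have e : exactG a m freq σ g t p - fieldG a m χ freq σ gj M p =
        g (a + p.2.1) (m * p.2.2.2 + p.2.2.1) p.2.2.2 t - ∑ j ∈ Finset.range M,
          p.1 ^ (2 * (j + 1)) * gj (j + 1) (a + p.2.1) (m * p.2.2.2 + p.2.2.1) p.2.2.2 := by
      simp only [exactG, fieldG, pullback, hχ1 _ hx, mul_one]
      ring
    rw [e]
    refine e₂.trans ?_
    calc C₂ * p.1 ^ (2 * (M + 1)) ≤ (C₁ + C₂) * p.1 ^ (2 * (M + 1)) := by gcongr; linarith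
      _ = (C₁ + C₂) * p.1 ^ (2 * M + 2) := by ring

/-! ### Expansions of the remainders. -/

section Remainder

variable {D : Set (ℝ × ℝ × ℝ)} {q n N : ℕ} {r c s₀ : ℝ} {σ : Pt → ℝ} {F G : ℕ → Pt → ℝ}
  {Fe Ge : ℝ → Pt → ℝ} {α' β' : Pt → ℝ}

/-- The approximant `Z i` uses the truncation `N + i`. With the prefactor `δ`, its distance to the
exact rate is `O(δ^{2(N+i)+1})`, within the allowed `δ^{N+i+1}`. Consecutive approximants agree to
order `2(N + i) ≥ N + i + 1`, where `N ≥ 1` is needed. -/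
theorem hasRemainderExpansion_radial (hn : 0 < n) (hN : 1 ≤ N)
    (hF' : ∀ M, HasOrder n (2 * M) fun p => F (M + 1) p - F M p)
    (hG' : ∀ M, HasOrder n (2 * M + 2) fun p => G (M + 1) p - G M p)
    (happ : ∀ M, ∃ C T : ℝ, 0 ≤ C ∧ 0 < T ∧ ∀ (t : ℝ) (p : Pt), T ≤ t → p.1 = timeScale q t →
      |p.2.1| ≤ c → |Fe t p - F M p| ≤ C * p.1 ^ (2 * M) ∧
        |Ge t p - G M p| ≤ C * p.1 ^ (2 * M + 2))
    (hα' : HasOrder n 1 α') (hβ' : IsSymbol n β')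
    (hΘ : ∀ p : Pt, |p.1| ≤ r → |p.2.1| ≤ r → |(shear α' β' p).2.1| ≤ c) (hr1 : r ≤ 1)
    (hD : ∀ ρ ψ t : ℝ, (ρ, ψ, t) ∈ D → 0 < t ∧ timeScale q t ≤ r ∧ |timeScale q t * ρ| ≤ r)
    {P U : Pt → ℝ} (hP : IsSymbol n P)
    (hE : ∀ M, N ≤ M → HasOrder n N fun p => radialRate q s₀ σ (F M) (G M) P p - U p)
    {h : ℝ → ℝ → ℝ → ℝ → ℝ} (hh : ∀ ρ ψ S t : ℝ, (ρ, ψ, t) ∈ D →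
      h ρ ψ S t = timeScale q t *
        (radialRate q s₀ σ (Fe t) (Ge t) P (shear α' β' (timeScale q t, timeScale q t * ρ, ψ, S))
          - U (shear α' β' (timeScale q t, timeScale q t * ρ, ψ, S)))) :
    HasRemainderExpansion D q n N 0 h := by
  refine hasRemainderExpansion_of_approx hn zero_le_one
    (Z := fun i p => radialRate q s₀ σ (F (N + i)) (G (N + i)) P (shear α' β' p)
      - U (shear α' β' p))
    (HasOrder.comp_shear hα' hβ' (hE N le_rfl)) (fun i => ?_)
    (fun ρ ψ t hp => ⟨(hD ρ ψ t hp).1, (hD ρ ψ t hp).2.1.trans hr1,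
      (hD ρ ψ t hp).2.2.trans hr1⟩) (fun i => ?_)
  · have h1 := hasOrder_radialRate_sub (q := q) (s₀ := s₀) (σ := σ) hP
      ((hF' (N + i)).mono (by omega : N + 0 + i + 1 ≤ _))
      ((hG' (N + i)).mono (by omega : N + 0 + i + 1 ≤ _))
    exact (HasOrder.comp_shear hα' hβ' h1).congr fun p => by simp only [← add_assoc]; ring
  · obtain ⟨C, T, hC, hT, hb⟩ := happ (N + i)
    obtain ⟨D₁, hD₁, h₁⟩ := (hP.directional (0, 1, 0, 0)).exists_bound hn (max r c)
    obtain ⟨D₂, hD₂, h₂⟩ := (hP.directional (0, 0, 1, 0)).exists_bound hn (max r c)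
    refine ⟨C + C * D₁ + C * D₂, T, by positivity, hT, fun ρ ψ S t hp ht => ?_⟩
    obtain ⟨ht0, hδr, hxr⟩ := hD ρ ψ t hp
    have hδ := timeScale_pos (q := q) ht0
    rw [hh ρ ψ S t hp]
    set p := shear α' β' (timeScale q t, timeScale q t * ρ, ψ, S) with hpdef
    have hp1 : p.1 = timeScale q t := rfl
    have hpr : |p.1| ≤ r := by rw [hp1, abs_of_pos hδ]; exact hδr
    have hpc : |p.2.1| ≤ c := hΘ _ hpr hxr
    obtain ⟨eF, eG⟩ := hb t p ht hp1 hpc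
    have e1 := h₁ p (hpr.trans (le_max_left _ _)) (hpc.trans (le_max_right _ _))
    have e2 := h₂ p (hpr.trans (le_max_left _ _)) (hpc.trans (le_max_right _ _))
    rw [← hp1] at hδ hδr ⊢
    have hd1 : p.1 ≤ 1 := hδr.trans hr1
    have e : p.1 * (radialRate q s₀ σ (Fe t) (Ge t) P p - U p) - p.1 ^ (1 - 0) *
        (radialRate q s₀ σ (F (N + i)) (G (N + i)) P p - U p)
        = p.1 * ((Fe t p - F (N + i) p) + (p.1 ^ 2 * (Fe t p - F (N + i) p) *
          dirDeriv (0, 1, 0, 0) P p + (Ge t p - G (N + i) p) * dirDeriv (0, 0, 1, 0) P p)) := by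
      rw [← radialRate_sub_radialRate (q := q) (s₀ := s₀) (σ := σ)]
      simp only [Nat.sub_zero, pow_one]
      ring
    rw [e, abs_mul, abs_of_pos hδ]
    calc _ ≤ p.1 * (C * p.1 ^ (2 * (N + i)) + (p.1 ^ 2 * (C * p.1 ^ (2 * (N + i))) * D₁
          + C * p.1 ^ (2 * (N + i) + 2) * D₂)) := by
          refine mul_le_mul_of_nonneg_left ?_ hδ.le
          refine (abs_add_le _ _).trans (add_le_add eF ((abs_add_le _ _).trans ?_))
          simp only [abs_mul, abs_pow, abs_of_pos hδ]
          gcongr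
      _ = p.1 ^ (2 * (N + i) + 1) * (C + C * p.1 ^ 2 * D₁ + C * p.1 ^ 2 * D₂) := by ring
      _ ≤ p.1 ^ (N + i + 1) * (C + C * 1 * D₁ + C * 1 * D₂) := by
          have : p.1 ^ 2 ≤ 1 := pow_le_one₀ hδ.le hd1
          gcongr ?_ * (C + C * ?_ * D₁ + C * ?_ * D₂)
          exact pow_le_pow_of_le_one hδ.le hd1 (by omega)
      _ = _ := by ring

theorem hasRemainderExpansion_angular (hn : 0 < n)
    (hF' : ∀ M, HasOrder n (2 * M) fun p => F (M + 1) p - F M p)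
    (hG' : ∀ M, HasOrder n (2 * M + 2) fun p => G (M + 1) p - G M p)
    (happ : ∀ M, ∃ C T : ℝ, 0 ≤ C ∧ 0 < T ∧ ∀ (t : ℝ) (p : Pt), T ≤ t → p.1 = timeScale q t →
      |p.2.1| ≤ c → |Fe t p - F M p| ≤ C * p.1 ^ (2 * M) ∧
        |Ge t p - G M p| ≤ C * p.1 ^ (2 * M + 2))
    (hα' : HasOrder n 1 α') (hβ' : IsSymbol n β')
    (hΘ : ∀ p : Pt, |p.1| ≤ r → |p.2.1| ≤ r → |(shear α' β' p).2.1| ≤ c) (hr1 : r ≤ 1)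
    (hD : ∀ ρ ψ t : ℝ, (ρ, ψ, t) ∈ D → 0 < t ∧ timeScale q t ≤ r ∧ |timeScale q t * ρ| ≤ r)
    {Q U : Pt → ℝ} (hQ : IsSymbol n Q)
    (hE : ∀ M, N ≤ M → HasOrder n (N + 1) fun p => angularRate q s₀ σ (F M) (G M) Q p - U p)
    {h : ℝ → ℝ → ℝ → ℝ → ℝ} (hh : ∀ ρ ψ S t : ℝ, (ρ, ψ, t) ∈ D →
      h ρ ψ S t =
        angularRate q s₀ σ (Fe t) (Ge t) Q (shear α' β' (timeScale q t, timeScale q t * ρ, ψ, S))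
          - U (shear α' β' (timeScale q t, timeScale q t * ρ, ψ, S))) :
    HasRemainderExpansion D q n N 1 h := by
  refine hasRemainderExpansion_of_approx hn le_rfl
    (Z := fun i p => angularRate q s₀ σ (F (N + i)) (G (N + i)) Q (shear α' β' p)
      - U (shear α' β' p))
    (HasOrder.comp_shear hα' hβ' (hE N le_rfl)) (fun i => ?_)
    (fun ρ ψ t hp => ⟨(hD ρ ψ t hp).1, (hD ρ ψ t hp).2.1.trans hr1,
      (hD ρ ψ t hp).2.2.trans hr1⟩) (fun i => ?_)
  · have h1 := hasOrder_angularRate_sub (q := q) (s₀ := s₀) (σ := σ) hQ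
      -- Here `F` enters only through `δ² F`, and the two extra orders make the truncation `N + i`
      -- sufficient even though the angular error is one order higher.
      (((hF' (N + i)).fst_pow_mul 2).mono (by omega : N + 1 + i + 1 ≤ _))
      ((hG' (N + i)).mono (by omega : N + 1 + i + 1 ≤ _))
    exact (HasOrder.comp_shear hα' hβ' h1).congr fun p => by simp only [← add_assoc]; ring
  · obtain ⟨C, T, hC, hT, hb⟩ := happ (N + i)
    obtain ⟨D₁, hD₁, h₁⟩ := (hQ.directional (0, 1, 0, 0)).exists_bound hn (max r c)
    obtain ⟨D₂, hD₂, h₂⟩ := (hQ.directional (0, 0, 1, 0)).exists_bound hn (max r c)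
    refine ⟨C + C * D₁ + C * D₂, T, by positivity, hT, fun ρ ψ S t hp ht => ?_⟩
    obtain ⟨ht0, hδr, hxr⟩ := hD ρ ψ t hp
    have hδ := timeScale_pos (q := q) ht0
    rw [hh ρ ψ S t hp]
    set p := shear α' β' (timeScale q t, timeScale q t * ρ, ψ, S) with hpdef
    have hp1 : p.1 = timeScale q t := rfl
    have hpr : |p.1| ≤ r := by rw [hp1, abs_of_pos hδ]; exact hδr
    have hpc : |p.2.1| ≤ c := hΘ _ hpr hxr
    obtain ⟨eF, eG⟩ := hb t p ht hp1 hpc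
    have e1 := h₁ p (hpr.trans (le_max_left _ _)) (hpc.trans (le_max_right _ _))
    have e2 := h₂ p (hpr.trans (le_max_left _ _)) (hpc.trans (le_max_right _ _))
    rw [← hp1] at hδ hδr ⊢
    have hd1 : p.1 ≤ 1 := hδr.trans hr1
    have e : angularRate q s₀ σ (Fe t) (Ge t) Q p - U p - p.1 ^ (1 - 1) *
        (angularRate q s₀ σ (F (N + i)) (G (N + i)) Q p - U p)
        = (Ge t p - G (N + i) p) + (p.1 ^ 2 * (Fe t p - F (N + i) p) *
          dirDeriv (0, 1, 0, 0) Q p + (Ge t p - G (N + i) p) * dirDeriv (0, 0, 1, 0) Q p) := by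
      rw [← angularRate_sub_angularRate (q := q) (s₀ := s₀) (σ := σ)]
      simp only [Nat.sub_self, pow_zero]
      ring
    rw [e]
    calc _ ≤ C * p.1 ^ (2 * (N + i) + 2) + (p.1 ^ 2 * (C * p.1 ^ (2 * (N + i))) * D₁
          + C * p.1 ^ (2 * (N + i) + 2) * D₂) := by
          refine (abs_add_le _ _).trans (add_le_add eG ((abs_add_le _ _).trans ?_))
          simp only [abs_mul, abs_pow, abs_of_pos hδ]
          gcongr
      _ = p.1 ^ (2 * (N + i) + 2) * (C + C * D₁ + C * D₂) := by ring
      _ ≤ p.1 ^ (N + i + 1) * (C + C * D₁ + C * D₂) := by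
          gcongr ?_ * _
          exact pow_le_pow_of_le_one hδ.le hd1 (by omega)
      _ = _ := by ring

end Remainder

/-! ### Orders of the truncated fields, and the equations of motion. -/

section Fields

variable {n q : ℕ} {a m : ℝ} {χ : ℝ → ℝ} {fj : ℕ → ℝ → ℝ → ℝ → ℝ}

theorem isSymbol_fieldF (h : ∀ j, IsSymbol n (pullback a m χ (fj (j + 1)))) (M : ℕ) :
    IsSymbol n (fieldF a m χ fj M) :=
  HasOrder.sum (k := 0) _ fun j _ => (IsSymbol.fst.pow (2 * j)).mul (h j)

theorem hasOrder_fieldF_succ_sub (h : ∀ j, IsSymbol n (pullback a m χ (fj (j + 1)))) (M : ℕ) :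
    HasOrder n (2 * M) fun p => fieldF a m χ fj (M + 1) p - fieldF a m χ fj M p := by
  have := HasOrder.fst_pow_mul (k := 0) (h M) (2 * M)
  rw [zero_add] at this
  refine this.congr fun p => ?_
  simp only [fieldF, Finset.sum_range_succ]
  ring

theorem hasOrder_fieldF_sub (h : ∀ j, IsSymbol n (pullback a m χ (fj (j + 1)))) (M : ℕ)
    (hM : 1 ≤ M) :
    HasOrder n 1 fun p => fieldF a m χ fj M p - pullback a m χ (fj 1) (core p) := by
  obtain ⟨M, rfl⟩ := Nat.exists_eq_add_of_le' hM
  refine ((isSymbol_fieldF h _).sub ((h 0).comp (isEquivariant_core n))).hasOrder_one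
    fun Ψ S => ?_
  simp [fieldF, Finset.sum_range_succ', core]

theorem hasOrder_fieldG_succ_sub {freq : ℝ → ℝ} {σ : Pt → ℝ}
    (h : ∀ j, IsSymbol n (pullback a m χ (fj (j + 1)))) (M : ℕ) :
    HasOrder n (2 * M + 2) fun p => fieldG a m χ freq σ fj (M + 1) p
      - fieldG a m χ freq σ fj M p := by
  have := HasOrder.fst_pow_mul (k := 0) (h M) (2 * M + 2)
  rw [zero_add] at this
  refine this.congr fun p => ?_
  simp only [fieldG, Finset.sum_range_succ]
  ring

theorem hasOrder_frequency {L c : ℝ} {freq : ℝ → ℝ} (hχ : ContDiff ℝ ∞ χ)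
    (hχL : ∀ x, |a + x * χ x| ≤ L) (hc : 0 < c) (hχ1 : ∀ x, |x| ≤ c → χ x = 1)
    (hfreq : ContDiffOn ℝ ∞ freq (Set.Icc (-L) L)) (haL : |a| < L) :
    HasOrder n 2 fun p => freq (a + p.2.1 * χ p.2.1) - freq a - deriv freq a * p.2.1 := by
  have hs : ContDiff ℝ ∞ fun p : Pt => freq (a + p.2.1 * χ p.2.1) :=
    hfreq.comp_contDiff (f := fun p : Pt => a + p.2.1 * χ p.2.1) (by fun_prop)
      fun p => abs_le.1 (hχL _)
  have hsym : IsSymbol n fun p : Pt =>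
      freq (a + p.2.1 * χ p.2.1) - freq a - deriv freq a * p.2.1 :=
    ⟨(hs.sub contDiff_const).sub (by fun_prop), fun w hw p => by simp [hw.snd_eq]⟩
  refine hsym.hasOrder_two (fun Ψ S => by simp) (fun Ψ S => ?_) (fun Ψ S => ?_)
  · refine dirDeriv_eq_of_hasDerivAt (hsym.differentiableAt _) ?_
    simpa using hasDerivAt_const (0 : ℝ) (0 : ℝ)
  · refine dirDeriv_eq_of_hasDerivAt (hsym.differentiableAt _) ?_
    have ha : HasDerivAt freq (deriv freq a) (a + 0) := by
      rw [add_zero]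
      have h1 : Set.Icc (-L) L ∈ nhds a := Icc_mem_nhds (abs_lt.1 haL).1 (abs_lt.1 haL).2
      exact ((hfreq.contDiffAt h1).differentiableAt (by norm_num)).hasDerivAt
    have h2 := ((ha.comp_const_add a 0).sub_const (freq a)).sub
      ((hasDerivAt_id (0 : ℝ)).const_mul (deriv freq a))
    have h3 : ∀ᶠ u : ℝ in nhds 0, |u| ≤ c := by
      have : Metric.closedBall (0 : ℝ) c ∈ nhds 0 := Metric.closedBall_mem_nhds _ hc
      filter_upwards [this] with u hu
      simpa using hu
    refine (h2.congr_of_eventuallyEq ?_).congr_deriv (by simp)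
    filter_upwards [h3] with u hu
    simp [hχ1 u hu]

theorem hasOrder_fieldG_sub {freq : ℝ → ℝ} {σ : Pt → ℝ} {η : ℝ} (hσ : HasOrder n 2 σ)
    (hfreq : HasOrder n 2 fun p => freq (a + p.2.1 * χ p.2.1) - freq a - η * p.2.1)
    (h : ∀ j, IsSymbol n (pullback a m χ (fj (j + 1)))) (M : ℕ) :
    HasOrder n 2 fun p => fieldG a m χ freq σ fj M p - η * p.2.1 := by
  have h1 : HasOrder n 2 fun p => ∑ j ∈ Finset.range M, p.1 ^ (2 * (j + 1)) *
      pullback a m χ (fj (j + 1)) p := HasOrder.sum _ fun j _ =>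
    (HasOrder.fst_pow_mul (k := 0) (h j) (2 * (j + 1))).mono (by omega)
  refine ((hfreq.add h1).sub (hσ.const_mul m)).congr fun p => ?_
  simp only [fieldG]
  ring

end Fields

theorem hasDerivAt_embed {q : ℕ} (hq : 1 ≤ q) {a m : ℝ} {s : ℕ → ℝ} {freq : ℝ → ℝ}
    {f g : ℝ → ℝ → ℝ → ℝ → ℝ} (hres : m * s 0 = freq a) {r φ R Ψ : ℝ → ℝ}
    (hr : ∀ t, 0 < t → r t = a + t ^ (-(1 / (2 * (q : ℝ)))) * R t)
    (hφ : ∀ t, 0 < t → φ t = m * phase q s t + Ψ t) {t : ℝ} (ht : 0 < t)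
    (hr' : HasDerivAt r (f (r t) (φ t) (phase q s t) t) t)
    (hφ' : HasDerivAt φ (freq (r t) + g (r t) (φ t) (phase q s t) t) t) :
    HasDerivAt (fun t => embed q s (R t) (Ψ t) t)
      (-(1 / (2 * (q : ℝ))) * (embed q s (R t) (Ψ t) t).1 ^ (2 * q + 1),
        (embed q s (R t) (Ψ t) t).1 ^ 2 * exactF q a m f t (embed q s (R t) (Ψ t) t),
        exactG a m freq (phaseDrift q s) g t (embed q s (R t) (Ψ t) t),
        s 0 + phaseDrift q s (embed q s (R t) (Ψ t) t)) t := by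
  have hev : ∀ᶠ u in nhds t, 0 < u := Ioi_mem_nhds ht
  have hδ := (timeScale_pos (q := q) ht).ne'
  have hS := hasDerivAt_phase hq s ht (p := embed q s (R t) (Ψ t) t) rfl
  have h1 : HasDerivAt (fun t => timeScale q t * R t) (f (r t) (φ t) (phase q s t) t) t := by
    refine (hr'.sub_const a).congr_of_eventuallyEq ?_
    filter_upwards [hev] with u hu
    rw [hr u hu, timeScale]
    ring
  have h2 : HasDerivAt Ψ (freq (r t) + g (r t) (φ t) (phase q s t) t
      - m * (s 0 + phaseDrift q s (embed q s (R t) (Ψ t) t))) t := by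
    refine (hφ'.sub (hS.const_mul m)).congr_of_eventuallyEq ?_
    filter_upwards [hev] with u hu
    simp [hφ u hu]
  refine ((hasDerivAt_timeScale hq ht).prodMk (h1.prodMk (h2.prodMk hS))).congr_deriv ?_
  have er : r t = a + timeScale q t * R t := hr t ht
  have eφ : φ t = m * phase q s t + Ψ t := hφ t ht
  ext
  · rfl
  · simp only [embed, exactF, ← er, ← eφ]
    field_simp
  · simp only [embed, exactG, ← er, ← eφ]
    -- The resonance relation cancels `freq a` against `m * s 0`.
    linear_combination -hres
  · rfl

/-! ### Assembly of the theorem. -/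

theorem mainTheorem3
    (L a : ℝ) (q : ℕ) (hq : 1 ≤ q)
    (freq : ℝ → ℝ) (hfreq : ContDiffOn ℝ ∞ freq (Set.Icc (-L) L)) (hpos : ∀ r, |r| ≤ L → 0 < freq r)
    (f g : ℝ → ℝ → ℝ → ℝ → ℝ) (hf : IsPerturbation L f) (hg : IsPerturbation L g)
    (fj gj : ℕ → ℝ → ℝ → ℝ → ℝ)
    (hfj : ∀ j, 1 ≤ j → IsCoefficient L (fj j)) (hgj : ∀ j, 1 ≤ j → IsCoefficient L (gj j))
    (hfas : HasPowerExpansion L q f fj) (hgas : HasPowerExpansion L q g gj)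
    (s : ℕ → ℝ) (hs : 0 < s 0)
    (κ κ' : ℕ) (hκ : 0 < κ) (hκ' : 0 < κ') (hcop : Nat.Coprime κ κ')
    (ha0 : 0 < |a|) (haL : |a| < L)
    (hres : (κ : ℝ) * s 0 = (κ' : ℝ) * freq a) (hη : deriv freq a ≠ 0) :
    ∃ Λ Ω : ℕ → ℝ → ℝ → ℝ,
      (∀ k, 1 ≤ k →
        IsPolynomialOfDegreeLE (k - 1) (Λ k) ∧ IsPolynomialOfDegreeLE k (Ω k)) ∧
      (∀ ρ ψ, Λ 1 ρ ψ =
        phaseAverage κ' (fun S => fj 1 a ((κ : ℝ) / (κ' : ℝ) * S + ψ) S)) ∧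
      (∀ ρ ψ, Ω 1 ρ ψ = deriv freq a * ρ) ∧
      ∀ N : ℕ, 1 ≤ N → ∀ ς ∈ Set.Ioo (0 : ℝ) 1, ∀ ε ∈ Set.Ioo (0 : ℝ) L,
        ∃ t₀ : ℝ, 1 ≤ t₀ ∧
        ∃ X Y : ℝ → ℝ → ℝ → ℝ, ∃ ΛN ΩN : ℝ → ℝ → ℝ → ℝ → ℝ,
          IsNearIdentityChange ε (resonanceDomain L a q 0 ς t₀) (resonanceDomain L a q ε ς t₀)
            X Y ∧
          -- every solution of the original system is carried into one of the new system
          (∀ r φ R Ψ ρ ψ : ℝ → ℝ,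
            (∀ t, 0 < t → r t = a + t ^ (-(1 / (2 * (q : ℝ)))) * R t) →
            (∀ t, 0 < t → φ t = (κ : ℝ) / (κ' : ℝ) * phase q s t + Ψ t) →
            (∀ t, 0 < t → ρ t = R t + X (R t) (Ψ t) t) →
            (∀ t, 0 < t → ψ t = Ψ t + Y (R t) (Ψ t) t) →
            ∀ t, (R t, Ψ t, t) ∈ resonanceDomain L a q 0 ς t₀ →
              (ρ t, ψ t, t) ∈ resonanceDomain L a q ε ς t₀ →
              HasDerivAt r (f (r t) (φ t) (phase q s t) t) t →
              HasDerivAt φ (freq (r t) + g (r t) (φ t) (phase q s t) t) t →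
              HasDerivAt ρ (ΛN (ρ t) (ψ t) (phase q s t) t) t ∧
              HasDerivAt ψ (ΩN (ρ t) (ψ t) (phase q s t) t) t) ∧
          (∀ ρ ψ S t : ℝ, (ρ, ψ, t) ∈ resonanceDomain L a q ε ς t₀ →
            ΛN ρ (ψ + 2 * Real.pi) S t = ΛN ρ ψ S t ∧
            ΛN ρ ψ (S + 2 * Real.pi * (κ' : ℝ)) t = ΛN ρ ψ S t ∧
            ΩN ρ (ψ + 2 * Real.pi) S t = ΩN ρ ψ S t ∧
            ΩN ρ ψ (S + 2 * Real.pi * (κ' : ℝ)) t = ΩN ρ ψ S t) ∧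
          -- the right-hand sides, up to `t^{-N/(2q)}`, and the expansions of the remainders
          ∃ Λrem Ωrem : ℝ → ℝ → ℝ → ℝ → ℝ,
            (∀ ρ ψ S t : ℝ, (ρ, ψ, t) ∈ resonanceDomain L a q ε ς t₀ →
              ΛN ρ ψ S t = ∑ k ∈ Finset.Icc 1 N, t ^ (-((k : ℝ) / (2 * (q : ℝ)))) * Λ k ρ ψ
                + Λrem ρ ψ S t ∧
              ΩN ρ ψ S t = ∑ k ∈ Finset.Icc 1 N, t ^ (-((k : ℝ) / (2 * (q : ℝ)))) * Ω k ρ ψ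
                + Ωrem ρ ψ S t) ∧
            IsRemainder (resonanceDomain L a q ε ς t₀) q N Λrem ∧
            IsRemainder (resonanceDomain L a q ε ς t₀) q N Ωrem ∧
            HasRemainderExpansion (resonanceDomain L a q ε ς t₀) q κ' N 0 Λrem ∧
            HasRemainderExpansion (resonanceDomain L a q ε ς t₀) q κ' N 1 Ωrem := by
  have hn : 0 < κ' := hκ'
  have hκ'0 : (κ' : ℝ) ≠ 0 := by positivity
  set m : ℝ := (κ : ℝ) / (κ' : ℝ) with hm
  have hmres : m * s 0 = freq a := by
    rw [hm]; field_simp; linarith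
  obtain ⟨_, -, hcut⟩ := exists_cutoff
  -- Since `|x χ₀(x)| ≤ 2c₀ = (L - |a|)/2`, the point `a + x χ₀(x)` stays in `[-L, L]`, and the
  -- pulled-back coefficients are smooth for all `x`.
  set c₀ : ℝ := (L - |a|) / 4 with hc₀
  have hc₀pos : 0 < c₀ := by rw [hc₀]; linarith
  obtain ⟨χ₀, hχ₀, hχ₀1, hχ₀2, -⟩ := hcut c₀ hc₀pos
  have hχL : ∀ x, |a + x * χ₀ x| ≤ L := fun x => by
    have h1 := abs_add_le a (x * χ₀ x)
    have h2 := hχ₀2 x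
    rw [hc₀] at h2
    linarith
  set σ := phaseDrift q s with hσdef
  have hσ : HasOrder κ' 2 σ := hasOrder_phaseDrift κ' hq s
  have hfs : ∀ j, IsSymbol κ' (pullback a m χ₀ (fj (j + 1))) := fun j =>
    isSymbol_pullback hκ' hχ₀ hχL (hfj (j + 1) (by omega))
  have hgs : ∀ j, IsSymbol κ' (pullback a m χ₀ (gj (j + 1))) := fun j =>
    isSymbol_pullback hκ' hχ₀ hχL (hgj (j + 1) (by omega))
  set F := fieldF a m χ₀ fj with hF
  set G := fieldG a m χ₀ freq σ gj with hG
  have hGη : ∀ M, HasOrder κ' 2 fun p => G M p - deriv freq a * p.2.1 :=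
    hasOrder_fieldG_sub hσ (hasOrder_frequency hχ₀ hχL hc₀pos hχ₀1 hfreq haL) hgs
  have hG1 : ∀ M, HasOrder κ' 1 (G M) := fun M =>
    ((hGη M).pred.add (HasOrder.snd.const_mul (deriv freq a))).congr fun p => by ring
  have hF' := hasOrder_fieldF_succ_sub hfs
  have hG' := hasOrder_fieldG_succ_sub (freq := freq) (σ := σ) hgs
  have happ := exists_field_bound (m := m) (freq := freq) (σ := σ) hq hfas hgas hχL hχ₀1
  obtain ⟨lam, om, hlam, hom, hind, hlam0, hom0, hN⟩ := exists_averaging (q := q) (s₀ := s 0) hn hq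
    hs.ne' hσ.pred (isSymbol_fieldF hfs) hG1 hF' hG'
    (h₀ := fun p => pullback a m χ₀ (fj 1) (core p))
    ⟨(hfs 0).comp (isEquivariant_core _), fun p => rfl⟩ (hasOrder_fieldF_sub hfs)
    (fun M _ => hGη M)
  refine ⟨fun k ρ ψ => lam (k - 1) (1, ρ, ψ, 0), fun k ρ ψ => om (k - 1) (1, ρ, ψ, 0),
    fun k hk => ⟨(hlam (k - 1)).isPolynomialOfDegreeLE, ?_⟩, fun ρ ψ => ?_, fun ρ ψ => ?_,
    fun N hN1 ς hς ε hε => ?_⟩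
  · have := (hom (k - 1)).isPolynomialOfDegreeLE
    rwa [Nat.sub_add_cancel hk] at this
  · beta_reduce
    rw [Nat.sub_self, hlam0]
    simp [pullback, core]
  · beta_reduce
    rw [Nat.sub_self, hom0]
  obtain ⟨P, Q, hP, hQ, hE⟩ := hN N hN1
  have hα : HasOrder κ' 2 fun p => p.1 ^ 2 * P p := by
    simpa using HasOrder.fst_pow_mul (k := 0) hP 2
  obtain ⟨c, hc, hcc₀, χ, hχ, hχ1, hχ2, α', β', hα', hβ', h12, h21⟩ :=
    exists_inverse_shear hn hα hQ c₀ hc₀pos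
  set α₀ : Pt → ℝ := fun p => (truncate χ p).1 ^ 2 * P (truncate χ p) with hα₀
  set β₀ : Pt → ℝ := fun p => Q (truncate χ p) with hβ₀
  have hα₀s : IsSymbol κ' α₀ := (hα.comp_truncate hχ).isSymbol
  have hβ₀2 : HasOrder κ' 2 β₀ := hQ.comp_truncate hχ
  obtain ⟨C₁, hC₁, hb₁⟩ := hP.exists_bound hn (2 * c)
  obtain ⟨C₂, hC₂, hb₂⟩ := hβ₀2.exists_bound hn 1
  obtain ⟨C₃, hC₃, hb₃⟩ := hα'.exists_bound hn 1
  obtain ⟨hε0, hεL⟩ := hε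
  -- The conditions on `r`: the inverse shear maps the box of size `r` strictly inside the region
  -- `|x| < c`, `|X| = δ |P| ≤ C₁ r ≤ ε`, and `|Y| ≤ C₂ (2r)² ≤ C₂ · 4r ≤ ε` as `r ≤ 1`.
  obtain ⟨r, hr0, hr1, hrc, hr₁, hr₂⟩ : ∃ r : ℝ, 0 < r ∧ r ≤ 1 ∧ (1 + 2 * C₃) * r ≤ c / 2 ∧
      C₁ * r ≤ ε ∧ C₂ * (4 * r) ≤ ε := by
    refine ⟨min (min 1 (c / (2 * (1 + 2 * C₃)))) (min (ε / (C₁ + 1)) (ε / (4 * (C₂ + 1)))),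
      by positivity, (min_le_left _ _).trans (min_le_left _ _), ?_, ?_, ?_⟩
    · have h := (min_le_left (min 1 (c / (2 * (1 + 2 * C₃)))) (min (ε / (C₁ + 1))
        (ε / (4 * (C₂ + 1))))).trans (min_le_right _ _)
      rw [le_div_iff₀ (by positivity)] at h
      linarith
    · have h := (min_le_right (min 1 (c / (2 * (1 + 2 * C₃)))) (min (ε / (C₁ + 1))
        (ε / (4 * (C₂ + 1))))).trans (min_le_left _ _)
      have h0 : 0 ≤ min (min 1 (c / (2 * (1 + 2 * C₃)))) (min (ε / (C₁ + 1))
        (ε / (4 * (C₂ + 1)))) := by positivity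
      rw [le_div_iff₀ (by positivity)] at h
      linarith
    · have h := (min_le_right (min 1 (c / (2 * (1 + 2 * C₃)))) (min (ε / (C₁ + 1))
        (ε / (4 * (C₂ + 1))))).trans (min_le_right _ _)
      have h0 : 0 ≤ min (min 1 (c / (2 * (1 + 2 * C₃)))) (min (ε / (C₁ + 1))
        (ε / (4 * (C₂ + 1)))) := by positivity
      rw [le_div_iff₀ (by positivity)] at h
      linarith
  have hrc' : r ≤ c / 2 := by nlinarith [mul_nonneg hC₃ hr0.le]
  obtain ⟨t₀, ht₀, hT⟩ := exists_time (ς := ς) hq haL hς.1 hr0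
  have hΘ : ∀ p : Pt, |p.1| ≤ r → |p.2.1| ≤ r → |(shear α' β' p).2.1| ≤ c := fun p h1 h2 => by
    have h3 := hb₃ p (h1.trans hr1) (h2.trans hr1)
    rw [pow_one] at h3
    calc |p.2.1 + α' p| ≤ |p.2.1| + |α' p| := abs_add_le _ _
      _ ≤ r + C₃ * (r + r) := by
        refine add_le_add h2 (h3.trans ?_)
        gcongr
      _ = (1 + 2 * C₃) * r := by ring
      _ ≤ c := by linarith
  have hD : ∀ ρ ψ t : ℝ, (ρ, ψ, t) ∈ resonanceDomain L a q ε ς t₀ →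
      0 < t ∧ timeScale q t ≤ r ∧ |timeScale q t * ρ| ≤ r := fun ρ ψ t h => by
    have h1 : t₀ ≤ t := h.2
    exact ⟨by linarith, (hT t h1).1, (hT t h1).2 _ _ _ _ hε0.le h⟩
  have htrunc : ∀ p : Pt, |p.1| ≤ c → |p.2.1| ≤ c → truncate χ p = p := fun p h1 h2 => by
    simp [truncate, hχ1 _ h1, hχ1 _ h2]
  -- On the domain the inverse shear lands where the cut-off is inactive, so there it also inverts
  -- the original near-identity map.
  have hnear : ∀ ρ ψ S t : ℝ, (ρ, ψ, t) ∈ resonanceDomain L a q ε ς t₀ →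
      nearIdentity P Q (shear α' β' (timeScale q t, timeScale q t * ρ, ψ, S))
        = (timeScale q t, timeScale q t * ρ, ψ, S) := fun ρ ψ S t h => by
    obtain ⟨h1, h2, h3⟩ := hD ρ ψ t h
    set p := shear α' β' (timeScale q t, timeScale q t * ρ, ψ, S) with hp
    have hδ : |timeScale q t| ≤ r := by rwa [abs_of_pos (timeScale_pos h1)]
    have h4 : truncate χ p = p := htrunc p (hδ.trans (by linarith)) (hΘ _ hδ h3)
    have h5 := h12 (timeScale q t, timeScale q t * ρ, ψ, S)
    rw [← hp] at h5
    rw [← h5]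
    simp only [nearIdentity, shear, hα₀, hβ₀, h4]
  -- The new right-hand sides are the exact rates at the inverse image of `(δ, δρ, ψ, S)`, with `S`
  -- kept as an independent variable.
  refine ⟨t₀, ht₀, fun R Ψ t => (timeScale q t)⁻¹ * α₀ (embed q s R Ψ t),
    fun R Ψ t => β₀ (embed q s R Ψ t),
    fun ρ ψ S t => timeScale q t * radialRate q (s 0) σ (exactF q a m f t)
      (exactG a m freq σ g t) P (shear α' β' (timeScale q t, timeScale q t * ρ, ψ, S)),
    fun ρ ψ S t => angularRate q (s 0) σ (exactF q a m f t)
      (exactG a m freq σ g t) Q (shear α' β' (timeScale q t, timeScale q t * ρ, ψ, S)),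
    ?_, ?_, ?_, ?_⟩
  · refine isNearIdentityChange_of_shear hα₀s hβ₀2.isSymbol hα'.isSymbol hβ' h12 h21
      (fun p h0 hpr => ?_) (fun p h1 h2 => ?_) ht₀ hT
    · have h1 : (truncate χ p).1 = p.1 := by
        simp [truncate, hχ1 p.1 (by rw [abs_of_pos h0]; linarith)]
      have h2 := hb₁ (truncate χ p) (hχ2 _) (hχ2 _)
      simp only [hα₀, h1, abs_mul, abs_pow, abs_of_pos h0]
      calc p.1 ^ 2 * |P (truncate χ p)| ≤ (p.1 * r) * C₁ := by
            rw [sq]; gcongr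
        _ = C₁ * r * p.1 := by ring
        _ ≤ ε * p.1 := by gcongr
    · refine (hb₂ p (h1.trans hr1) (h2.trans hr1)).trans (le_trans ?_ hr₂)
      have h3 : (|p.1| + |p.2.1|) ^ 2 ≤ (r + r) ^ 2 := by gcongr
      gcongr
      nlinarith
  · intro rr φ R Ψ ρ ψ hrr hφ hρ hψ t hD0 hD1 hr' hφ'
    have ht : 0 < t := (hD _ _ t hD1).1
    have htt : t₀ ≤ t := hD1.2
    set z : ℝ → Pt := fun t => embed q s (R t) (Ψ t) t with hz
    have hzd : HasDerivAt z (-(1 / (2 * (q : ℝ))) * (z t).1 ^ (2 * q + 1),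
        (z t).1 ^ 2 * exactF q a m f t (z t), exactG a m freq σ g t (z t), s 0 + σ (z t)) t :=
      hasDerivAt_embed hq hmres hrr hφ ht hr' hφ'
    have hz1 : |(z t).1| ≤ r := by
      change |timeScale q t| ≤ r
      rw [abs_of_pos (timeScale_pos ht)]
      exact (hT t htt).1
    have hz2 : |(z t).2.1| ≤ r := (hT t htt).2 _ _ _ _ le_rfl hD0
    have hrltc : r < c := by linarith
    -- To differentiate at `t`, the cut-off must be inactive on a neighbourhood of `t`; the strict
    -- inequality `r < c` and the continuity of `z` provide this.
    have hev : ∀ᶠ u in nhds t, 0 < u ∧ truncate χ (z u) = z u := by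
      have e1 : ∀ᶠ u in nhds t, |(z u).1| < c :=
        hzd.continuousAt.fst.abs.eventually_lt_const (hz1.trans_lt hrltc)
      have e2 : ∀ᶠ u in nhds t, |(z u).2.1| < c :=
        hzd.continuousAt.snd.fst.abs.eventually_lt_const (hz2.trans_lt hrltc)
      filter_upwards [e1, e2, Ioi_mem_nhds ht] with u h1 h2 h3
      exact ⟨h3, htrunc _ h1.le h2.le⟩
    have hΘz : shear α' β' (timeScale q t, timeScale q t * ρ t, ψ t, phase q s t) = z t := by
      have h1 := shear_embed (q := q) α₀ β₀ s (R t) (Ψ t) ht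
      rw [← hρ t ht, ← hψ t ht] at h1
      have h2 := h21 (z t)
      rw [show shear (fun p => (truncate χ p).1 ^ 2 * P (truncate χ p))
        (fun p => Q (truncate χ p)) (z t) = embed q s (ρ t) (ψ t) t from h1] at h2
      exact h2
    have hz0 : (z t).1 ≠ 0 := (timeScale_pos ht).ne'
    simp only [hΘz]
    constructor
    · refine (hasDerivAt_radius_of_flow hq hzd (hP.differentiableAt _)
        hz0).congr_of_eventuallyEq ?_
      filter_upwards [hev] with u hu
      have hδu := (timeScale_pos (q := q) hu.1).ne'
      rw [hρ u hu.1]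
      change R u + (timeScale q u)⁻¹ * ((truncate χ (z u)).1 ^ 2 * P (truncate χ (z u))) = _
      rw [hu.2]
      change R u + (timeScale q u)⁻¹ * (timeScale q u ^ 2 * P (z u))
        = (timeScale q u)⁻¹ * (timeScale q u * R u) + timeScale q u * P (z u)
      field_simp
    · have h1 := (hasDerivAt_comp_of_flow hzd (hQ.isSymbol.differentiableAt _))
      have h2 : HasDerivAt (fun t => (z t).2.2.1) (exactG a m freq σ g t (z t)) t :=
        (((ContinuousLinearMap.fst ℝ ℝ ℝ).comp ((ContinuousLinearMap.snd ℝ ℝ (ℝ × ℝ)).comp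
          (ContinuousLinearMap.snd ℝ ℝ (ℝ × ℝ × ℝ)))).hasFDerivAt).comp_hasDerivAt t hzd
      refine (h2.add h1).congr_of_eventuallyEq ?_
      filter_upwards [hev] with u hu
      rw [hψ u hu.1]
      change Ψ u + Q (truncate χ (z u)) = Ψ u + Q (z u)
      rw [hu.2]
  · intro ρ ψ S t hρ
    obtain ⟨h1, h2, h3⟩ := hD ρ ψ t hρ
    have hδ : |timeScale q t| ≤ r := by rwa [abs_of_pos (timeScale_pos h1)]
    have hper : ∀ w, IsPeriod κ' w → ∀ p : Pt, |p.2.1| ≤ c →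
        exactF q a m f t (p + w) = exactF q a m f t p ∧
        exactG a m freq σ g t (p + w) = exactG a m freq σ g t p := by
      intro w hw p hp
      have hr : |a + p.2.1| ≤ L := by
        simpa [hχ₀1 _ (hp.trans hcc₀)] using hχL p.2.1
      have ef := fun Ψ S => resonant_shift_eq (κ := κ) hκ' (c := fun φ S => f (a + p.2.1) φ S t)
        (fun φ S => (hf.2 _ φ S t hr h1).1) (fun φ S => (hf.2 _ φ S t hr h1).2) Ψ S
      have eg := fun Ψ S => resonant_shift_eq (κ := κ) hκ' (c := fun φ S => g (a + p.2.1) φ S t)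
        (fun φ S => (hg.2 _ φ S t hr h1).1) (fun φ S => (hg.2 _ φ S t hr h1).2) Ψ S
      have es := hσ.isSymbol.periodic w hw p
      simp only [exactF, exactG, es]
      rcases hw with rfl | rfl
      · simpa using ⟨Or.inl (ef p.2.2.1 p.2.2.2).1, (eg p.2.2.1 p.2.2.2).1⟩
      · simpa using ⟨Or.inl (ef p.2.2.1 p.2.2.2).2, (eg p.2.2.1 p.2.2.2).2⟩
    have hshift : ∀ w, IsPeriod κ' w →
        radialRate q (s 0) σ (exactF q a m f t) (exactG a m freq σ g t) P
            (shear α' β' ((timeScale q t, timeScale q t * ρ, ψ, S) + w))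
          = radialRate q (s 0) σ (exactF q a m f t) (exactG a m freq σ g t) P
            (shear α' β' (timeScale q t, timeScale q t * ρ, ψ, S)) ∧
        angularRate q (s 0) σ (exactF q a m f t) (exactG a m freq σ g t) Q
            (shear α' β' ((timeScale q t, timeScale q t * ρ, ψ, S) + w))
          = angularRate q (s 0) σ (exactF q a m f t) (exactG a m freq σ g t) Q
            (shear α' β' (timeScale q t, timeScale q t * ρ, ψ, S)) := by
      intro w hw
      rw [(isEquivariant_shear hα'.isSymbol hβ').equivariant w hw]
      obtain ⟨e1, e2⟩ := hper w hw _ (hΘ (timeScale q t, timeScale q t * ρ, ψ, S) hδ h3)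
      simp only [radialRate, angularRate, transport, e1, e2, hP.periodic w hw,
        hσ.isSymbol.periodic w hw, (hP.directional _).periodic w hw,
        (hQ.isSymbol.directional _).periodic w hw, Prod.fst_add, Prod.snd_add, hw.fst_eq,
        hw.snd_eq, add_zero, and_self]
    have s1 := hshift _ (Or.inl rfl)
    have s2 := hshift _ (Or.inr rfl)
    simp only [Prod.mk_add_mk, add_zero] at s1 s2
    simp only [s1.1, s1.2, s2.1, s2.2, and_self]
  -- The cases are `d = 0` for `lam`, whose rate has a prefactor `δ`, and `d = 1` for `om`. In both,
  -- the form with index `j` contributes the power `δ^{j+1}`.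
  · have hsum : ∀ (d : ℕ) (k : ℕ → Pt → ℝ), (∀ j, IsForm κ' (j + d) (k j)) →
        (∀ j δ x Ψ S, k j (δ, x, Ψ, S) = k j (δ, x, Ψ, 0)) → d ≤ 1 → ∀ ρ ψ S t : ℝ,
        (ρ, ψ, t) ∈ resonanceDomain L a q ε ς t₀ →
        ∑ j ∈ Finset.Icc 1 N, t ^ (-((j : ℝ) / (2 * (q : ℝ)))) * k (j - 1) (1, ρ, ψ, 0)
          = timeScale q t ^ (1 - d) * ∑ j ∈ Finset.range N,
            k j (nearIdentity P Q (shear α' β' (timeScale q t, timeScale q t * ρ, ψ, S))) := by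
      intro d k hk hS hd ρ ψ S t h
      have ht := (hD ρ ψ t h).1
      rw [← Finset.Ico_add_one_right_eq_Icc, Finset.sum_Ico_eq_sum_range, Finset.mul_sum,
        Nat.add_sub_cancel]
      refine Finset.sum_congr rfl fun j _ => ?_
      rw [hnear ρ ψ S t h, hS j _ _ ψ S, (hk j).homogeneous, rpow_eq_timeScale_pow ht, ← mul_assoc,
        ← pow_add, add_tsub_cancel_left, show 1 - d + (j + d) = 1 + j by omega]
    have eΛ := hsum 0 lam hlam (fun j δ x Ψ S => (hind j δ x Ψ S).1) zero_le_one
    have eΩ := hsum 1 om hom (fun j δ x Ψ S => (hind j δ x Ψ S).2) le_rfl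
    have happ' : ∀ M, ∃ C T : ℝ, 0 ≤ C ∧ 0 < T ∧ ∀ (t : ℝ) (p : Pt), T ≤ t →
        p.1 = timeScale q t → |p.2.1| ≤ c → |exactF q a m f t p - F M p| ≤ C * p.1 ^ (2 * M) ∧
          |exactG a m freq σ g t p - G M p| ≤ C * p.1 ^ (2 * M + 2) := fun M => by
      obtain ⟨C, T, hC, hT, hb⟩ := happ M
      exact ⟨C, T, hC, hT, fun t p h1 h2 h3 => hb t p h1 h2 (h3.trans hcc₀)⟩
    have hrad := hasRemainderExpansion_radial hn hN1 hF' hG' happ' hα' hβ' hΘ hr1 hD hP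
      (fun M hM => (hE M hM).1) (fun ρ ψ S t _ => rfl)
    have hang := hasRemainderExpansion_angular hn hF' hG' happ' hα' hβ' hΘ hr1 hD hQ.isSymbol
      (fun M hM => (hE M hM).2) (fun ρ ψ S t _ => rfl)
    refine ⟨_, _, fun ρ ψ S t h => ⟨?_, ?_⟩, hrad.isRemainder, hang.isRemainder, hrad, hang⟩
    · beta_reduce
      rw [eΛ ρ ψ S t h]
      ring
    · beta_reduce
      rw [eΩ ρ ψ S t h]
      ring
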